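/- A melon graph is a graph $G=(V,E)$ that is the parallel composition of $k\ge 1$ paths, each of length at least $1$, between two distinct vertices $s$ and $t$: the paths share no vertex other than $s,t$ and no edge, and $G$ is their union (parallel edges arise if several of the paths have length $1$). An eternal vertex cover class of a graph $G$ is a nonempty family $\mathcal U$ of vertex covers of $G$, all of the same cardinality (the size of the class), such that for every $U\in\mathcal U$ and every edge $e$ there are $U'\in\mathcal U$ and a bijection $\varphi:U\to U'$ with $\varphi(u)\in N[u]$ for all $u\in U$ and, for some $v\in U$, with $e$ joining $v$ and $\varphi(v)$. The eternal vertex cover number $\mathrm{evc}(G)$ is the minimum size of an eternal vertex cover class of $G$, and {\sc Minimum Eternal Vertex Cover} is the problem of computing $\mathrm{evc}(G)$ from $G$. Theorem 1. {\sc Minimum Eternal Vertex Cover} can be solved in linear time on melon graphs. Precisely: there are a random access machine program (unit cost; instructions: load a constant, addition, truncated subtraction, indirect load and store, conditional jump) and a constant $C$ such that, for every melon graph $G=(V,E)$ given by adjacency lists (with the vertices numbered $0,\dots,|V|-1$ in any order and each list in any order, and without $s$, $t$ or the paths being given), the program halts after at most $C(|V|+|E|)$ steps with output $\mathrm{evc}(G)$,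 and no number held in a register or memory cell during the computation exceeds $C(|V|+|E|)$. -/

import Mathlib

/-! ### Eternal vertex covers -/

namespace Graph

universe u v

variable {α : Type u} {β : Type v}

/-- `U` is a set of vertices of `G` that meets every edge of `G`. -/
def IsVertexCover (G : Graph α β) (U : Finset α) : Prop :=
  (∀ x ∈ U, x ∈ G.vertexSet) ∧ ∀ e x y, G.IsLink e x y → x ∈ U ∨ y ∈ U

/-- `φ` is a defense of `G` from the attack on the edge `e`, shifting the guards from `U` to `U'`:
it is one-to-one on `U` with image `U'`, every guard stays or moves to an adjacent vertex,
and some guard moves along `e`. -/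
def IsDefense (G : Graph α β) (e : β) (U U' : Finset α) (φ : α → α) : Prop :=
  Set.BijOn φ (U : Set α) (U' : Set α) ∧
    (∀ x ∈ U, φ x = x ∨ G.Adj x (φ x)) ∧
    ∃ x ∈ U, G.IsLink e x (φ x)

/-- A (nonempty) family `𝒰` of vertex covers of `G`, all of the same cardinality, such that from
each member any attacked edge can be protected by shifting to a member. -/
def IsEternalVertexCoverClass (G : Graph α β) (𝒰 : Set (Finset α)) : Prop :=
  𝒰.Nonempty ∧
    (∀ U ∈ 𝒰, G.IsVertexCover U) ∧
    (∀ U ∈ 𝒰, ∀ U' ∈ 𝒰, U.card = U'.card) ∧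
    ∀ U ∈ 𝒰, ∀ e ∈ G.edgeSet, ∃ U' ∈ 𝒰, ∃ φ, G.IsDefense e U U' φ

/-- The sizes of the eternal vertex cover classes of `G`. -/
def eternalVertexCoverSizes (G : Graph α β) : Set ℕ :=
  {m | ∃ 𝒰 : Set (Finset α), G.IsEternalVertexCoverClass 𝒰 ∧ ∀ U ∈ 𝒰, U.card = m}

/-- The eternal vertex cover number: the minimum size of an eternal vertex cover class. -/
noncomputable def evc (G : Graph α β) : ℕ := sInf G.eternalVertexCoverSizes

/-- On a finite graph the minimum exists (a guard on every vertex suffices). -/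
theorem isLeast_evc (G : Graph α β) (hV : G.vertexSet.Finite) :
    IsLeast G.eternalVertexCoverSizes G.evc := by
  classical
  have hne : G.eternalVertexCoverSizes.Nonempty := by
    refine ⟨hV.toFinset.card, {hV.toFinset}, ⟨⟨_, rfl⟩, ?_, ?_, ?_⟩, ?_⟩
    · rintro U rfl
      exact ⟨fun x hx => by simpa using hx,
        fun e x y h => Or.inl (by simpa using h.left_mem)⟩
    · rintro U rfl U' rfl
      rfl
    · rintro U rfl e he
      obtain ⟨x, y, h⟩ := G.exists_isLink_of_mem_edgeSet he
      refine ⟨_, rfl, Equiv.swap x y, ⟨?_, (Equiv.injective _).injOn, ?_⟩, ?_, x, ?_, ?_⟩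
      · intro z hz
        simp only [Set.Finite.coe_toFinset] at hz ⊢
        rw [Equiv.swap_apply_def]
        split_ifs
        exacts [h.right_mem, h.left_mem, hz]
      · intro z hz
        simp only [Set.Finite.coe_toFinset] at hz ⊢
        refine ⟨Equiv.swap x y z, ?_, Equiv.swap_apply_self x y z⟩
        rw [Equiv.swap_apply_def]
        split_ifs
        exacts [h.right_mem, h.left_mem, hz]
      · intro z _
        rw [Equiv.swap_apply_def]
        split_ifs with h1 h2
        · exact Or.inr ⟨e, h1 ▸ h⟩
        · exact Or.inr ⟨e, h2 ▸ h.symm⟩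
        · exact Or.inl rfl
      · simpa using h.left_mem
      · rwa [Equiv.swap_apply_left]
    · rintro U rfl
      rfl
  exact ⟨Nat.sInf_mem hne, fun m hm => Nat.sInf_le hm⟩

/-! ### Melon graphs -/

/-- `G` is the parallel composition of `k ≥ 1` paths between `s` and `t`; the `i`-th path has
length `len i ≥ 1`, successive vertices `p i 0 = s, p i 1, …, p i (len i) = t`, and successive
edges `e i 0, …, e i (len i - 1)`. The paths share no vertex except `s` and `t`, and no edge;
several paths of length one give parallel edges. -/
structure IsParallelCompositionOfPaths (G : Graph α β) (s t : α) (k : ℕ) (len : Fin k → ℕ)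
    (p : Fin k → ℕ → α) (e : Fin k → ℕ → β) : Prop where
  one_le_k : 1 ≤ k
  one_le_len : ∀ i, 1 ≤ len i
  source_ne_sink : s ≠ t
  first : ∀ i, p i 0 = s
  last : ∀ i, p i (len i) = t
  inner_ne : ∀ i j, 0 < j → j < len i → p i j ≠ s ∧ p i j ≠ t
  inner_inj : ∀ i j i' j', 0 < j → j < len i → 0 < j' → j' < len i' →
    p i j = p i' j' → i = i' ∧ j = j'
  edge_inj : ∀ i j i' j', j < len i → j' < len i' → e i j = e i' j' → i = i' ∧ j = j'
  isLink : ∀ i j, j < len i → G.IsLink (e i j) (p i j) (p i (j + 1))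
  vertexSet_eq : G.vertexSet = {x | ∃ i, ∃ j ≤ len i, x = p i j}
  edgeSet_eq : G.edgeSet = {f | ∃ i, ∃ j < len i, f = e i j}

/-- `G` is a melon graph: the parallel composition of one or more paths. -/
def IsMelon (G : Graph α β) : Prop :=
  ∃ (s t : α) (k : ℕ) (len : Fin k → ℕ) (p : Fin k → ℕ → α) (e : Fin k → ℕ → β),
    G.IsParallelCompositionOfPaths s t k len p e

/-! ### Adjacency lists -/

/-- `A` is an adjacency-list representation of `G`: for some numbering `σ` of the vertices of `G`
by `0, …, A.length - 1`, the list `A[a]` consists of numbers of vertices, in any order, and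
contains `b` as often as there are edges between `σ a` and `σ b`. -/
def IsAdjacencyList (G : Graph α β) (A : List (List ℕ)) : Prop :=
  ∃ σ : ℕ → α, Set.BijOn σ (Set.Iio A.length) G.vertexSet ∧
    ∀ (a : ℕ) (ha : a < A.length), (∀ b ∈ A[a], b < A.length) ∧
      ∀ b < A.length, ((A[a].count b : ℕ) : ℕ∞) = {e | G.IsLink e (σ a) (σ b)}.encard

end Graph

/-- The adjacency lists `A = [A₀, …, Aₙ₋₁]` laid out in memory as one array of numbers:
`n`, then the addresses at which `A₀, …, Aₙ₋₁` begin followed by the address after the end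
of `Aₙ₋₁`, and then the entries of `A₀`, of `A₁`, and so on. -/
def encodeAdjacencyList (A : List (List ℕ)) : List ℕ :=
  A.length ::
    ((List.range (A.length + 1)).map (fun v => A.length + 2 + (A.take v).flatten.length) ++
      A.flatten)

/-! ### Random access machines -/

namespace RAM

/-- Instructions of a random access machine; `i`, `j`, `k` name registers, `l` is a position in
the program. -/
inductive Instr where
  /-- `rᵢ := c` -/
  | const (i c : ℕ)
  /-- `rᵢ := rⱼ + rₖ` -/
  | add (i j k : ℕ)
  /-- `rᵢ := max (rⱼ - rₖ) 0` -/
  | sub (i j k : ℕ)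
  /-- `rᵢ := mem[rⱼ]` -/
  | load (i j : ℕ)
  /-- `mem[rᵢ] := rⱼ` -/
  | store (i j : ℕ)
  /-- if `rᵢ = 0`, continue at position `l` -/
  | jumpIfZero (i l : ℕ)

/-- A program is a finite list of instructions. -/
abbrev Program := List Instr

/-- A configuration: the position in the program, the registers, and the memory. -/
structure Config where
  pc : ℕ
  reg : ℕ → ℕ
  mem : ℕ → ℕ

/-- The effect of one instruction. -/
def Instr.exec : Instr → Config → Config
  | const i c, s => ⟨s.pc + 1, Function.update s.reg i c, s.mem⟩
  | add i j k, s => ⟨s.pc + 1, Function.update s.reg i (s.reg j + s.reg k), s.mem⟩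
  | sub i j k, s => ⟨s.pc + 1, Function.update s.reg i (s.reg j - s.reg k), s.mem⟩
  | load i j, s => ⟨s.pc + 1, Function.update s.reg i (s.mem (s.reg j)), s.mem⟩
  | store i j, s => ⟨s.pc + 1, s.reg, Function.update s.mem (s.reg i) (s.reg j)⟩
  | jumpIfZero i l, s => ⟨if s.reg i = 0 then l else s.pc + 1, s.reg, s.mem⟩

/-- The machine has halted when the position is not one of an instruction of the program. -/
def Halted (P : Program) (s : Config) : Prop := P.length ≤ s.pc

/-- One step: execute the instruction at the current position, if there is one. -/
def step (P : Program) (s : Config) : Config :=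
  match P[s.pc]? with
  | some I => I.exec s
  | none => s

/-- Initially the input stands in `mem[0], mem[1], …`, and everything else is `0`. -/
def init (input : List ℕ) : Config := ⟨0, fun _ => 0, fun a => input.getD a 0⟩

/-- The configuration after `τ` steps on the given input. -/
def run (P : Program) (input : List ℕ) (τ : ℕ) : Config := (step P)^[τ] (init input)

/-- On the given input, `P` halts after at most `T` steps with `output` in register `0`, and
no register and no memory cell ever holds a number greater than `W`. -/
def Computes (P : Program) (input : List ℕ) (output T W : ℕ) : Prop :=
  ∃ τ ≤ T, Halted P (run P input τ) ∧ (run P input τ).reg 0 = output ∧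
    ∀ τ' ≤ τ, ∀ a, (run P input τ').reg a ≤ W ∧ (run P input τ').mem a ≤ W

end RAM

/-! The number depends only on the number `n` of vertices, the number `k` of paths and the number
`q` of paths of even length (`evc_eq`), and these can be found by walking once along every path.
Write `H = ∑ i, len i / 2`, so that `2 * H + 2 = n + q`.

Lower bounds. A vertex cover that misses exactly one of `s`, `t` has at least `H + 1` vertices, one
that misses both at least `H + k - q`, and one that contains both at least `H + 2 - q`. If every
member of a class contains both ends and `q ≥ 1`, the size `H + 2 - q` is impossible: it leaves no
guard beside `s` on an even path, and the edge there cannot be defended (`le_of_forall_both`). On a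
single path, repeated attacks force guards onto all vertices but one (`le_of_eq_one`).

Upper bounds. The inner guards of each path stand at every second position, and a path answers an
attack by shifting all its guards one step in the same direction. Exactly one direction crosses a
given edge, so it suffices to find a family of placements in which each path can be shifted either
way while the other paths repair `s` and `t` (`mem_sizes_of_placements`). Such families are
`surplus` for `q ≥ 2`, of size `H + 3 - q`; `alternating` for `q = 0` and `oneEven` for `q = 1`, of
size `H + 1`; and `evenAlternating` for even cycles with two even paths, of size `H`. A single path
uses all sets missing one vertex.

Algorithm. The total length of the lists gives `k`, which settles `k ≤ 2`. For `k ≥ 3` exactly `s`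
and `t` have degree at least three. From the first such vertex every path is followed to its other
end, recording the parity of its length; the next vertex is the sum of the two neighbours minus the
previous vertex. Since a melon graph can be read from either end, it does not matter which end is
found. -/

namespace Graph

/-! ### The structure of melon graphs -/

namespace IsParallelCompositionOfPaths

variable {α β : Type*} {G : Graph α β} {s t : α} {k : ℕ} {len : Fin k → ℕ} {p : Fin k → ℕ → α}
  {e : Fin k → ℕ → β}

theorem apply_eq_source_iff (h : G.IsParallelCompositionOfPaths s t k len p e) {i : Fin k} {j : ℕ}
    (hj : j ≤ len i) : p i j = s ↔ j = 0 := by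
  refine ⟨fun hs => ?_, fun hs => hs ▸ h.first i⟩
  by_contra h0
  rcases hj.lt_or_eq with hlt | rfl
  · exact (h.inner_ne i j (by omega) hlt).1 hs
  · exact h.source_ne_sink (hs.symm.trans (h.last i))

theorem apply_eq_sink_iff (h : G.IsParallelCompositionOfPaths s t k len p e) {i : Fin k} {j : ℕ}
    (hj : j ≤ len i) : p i j = t ↔ j = len i := by
  refine ⟨fun ht => ?_, fun ht => ht ▸ h.last i⟩
  by_contra h0
  rcases Nat.eq_zero_or_pos j with rfl | hpos
  · exact h.source_ne_sink ((h.first i).symm.trans ht)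
  · exact (h.inner_ne i j hpos (by omega)).2 ht

/-- Equal vertices have equal positions, unless they are the source or the sink. -/
theorem eq_cases (h : G.IsParallelCompositionOfPaths s t k len p e) {i i' : Fin k} {j j' : ℕ}
    (hj : j ≤ len i) (hj' : j' ≤ len i') (hp : p i j = p i' j') :
    (j = 0 ∧ j' = 0) ∨ (j = len i ∧ j' = len i') ∨
      (i = i' ∧ j = j' ∧ 0 < j ∧ j < len i) := by
  by_cases h0 : j = 0
  · subst h0
    rw [h.first] at hp
    exact Or.inl ⟨rfl, (h.apply_eq_source_iff hj').1 hp.symm⟩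
  by_cases h1 : j = len i
  · subst h1
    rw [h.last] at hp
    exact Or.inr (Or.inl ⟨rfl, (h.apply_eq_sink_iff hj').1 hp.symm⟩)
  have h2 := h.inner_ne i j (by omega) (by omega)
  have h3 : j' ≠ 0 := fun h3 => h2.1 (by rw [hp, h3, h.first])
  have h4 : j' ≠ len i' := fun h4 => h2.2 (by rw [hp, h4, h.last])
  obtain ⟨rfl, rfl⟩ := h.inner_inj i j i' j' (by omega) (by omega) (by omega) (by omega) hp
  exact Or.inr (Or.inr ⟨rfl, rfl, by omega, by omega⟩)

theorem apply_injective (h : G.IsParallelCompositionOfPaths s t k len p e) {i : Fin k} {j j' : ℕ}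
    (hj : j ≤ len i) (hj' : j' ≤ len i) (hp : p i j = p i j') : j = j' := by
  have := h.eq_cases hj hj' hp
  omega

theorem apply_ne_apply_succ (h : G.IsParallelCompositionOfPaths s t k len p e) {i : Fin k} {j : ℕ}
    (hj : j < len i) : p i j ≠ p i (j + 1) := fun hp => by
  have := h.apply_injective hj.le hj hp
  omega

theorem isLink_iff (h : G.IsParallelCompositionOfPaths s t k len p e) {f : β} {x y : α} :
    G.IsLink f x y ↔ ∃ i, ∃ j < len i, f = e i j ∧
      ((x = p i j ∧ y = p i (j + 1)) ∨ (x = p i (j + 1) ∧ y = p i j)) := by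
  constructor
  · intro hf
    have hm := hf.edge_mem
    rw [h.edgeSet_eq] at hm
    obtain ⟨i, j, hj, rfl⟩ := hm
    exact ⟨i, j, hj, rfl, hf.eq_and_eq_or_eq_and_eq (h.isLink i j hj)⟩
  · rintro ⟨i, j, hj, rfl, ⟨rfl, rfl⟩ | ⟨rfl, rfl⟩⟩
    · exact h.isLink i j hj
    · exact (h.isLink i j hj).symm

theorem mem_vertexSet_iff (h : G.IsParallelCompositionOfPaths s t k len p e) {x : α} :
    x ∈ G.vertexSet ↔ x = s ∨ x = t ∨ ∃ i j, 0 < j ∧ j < len i ∧ x = p i j := by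
  rw [h.vertexSet_eq]
  constructor
  · rintro ⟨i, j, hj, rfl⟩
    by_cases h0 : j = 0
    · exact Or.inl (h0 ▸ h.first i)
    by_cases h1 : j = len i
    · exact Or.inr (Or.inl (h1 ▸ h.last i))
    · exact Or.inr (Or.inr ⟨i, j, by omega, by omega, rfl⟩)
  · have i : Fin k := ⟨0, h.one_le_k⟩
    rintro (rfl | rfl | ⟨i, j, _, hj, rfl⟩)
    · exact ⟨i, 0, by omega, (h.first i).symm⟩
    · exact ⟨i, _, le_rfl, (h.last i).symm⟩
    · exact ⟨i, j, hj.le, rfl⟩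

theorem mem_vertexSet (h : G.IsParallelCompositionOfPaths s t k len p e) {i : Fin k} {j : ℕ}
    (hj : j ≤ len i) : p i j ∈ G.vertexSet := by
  rw [h.vertexSet_eq]
  exact ⟨i, j, hj, rfl⟩

/-- A melon graph read from the sink to the source. -/
theorem reverse (h : G.IsParallelCompositionOfPaths s t k len p e) :
    G.IsParallelCompositionOfPaths t s k len (fun i j => p i (len i - j))
      (fun i j => e i (len i - 1 - j)) where
  one_le_k := h.one_le_k
  one_le_len := h.one_le_len
  source_ne_sink := h.source_ne_sink.symm
  first i := h.last i
  last i := by simpa using h.first i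
  inner_ne i j h0 h1 := (h.inner_ne i (len i - j) (by omega) (by omega)).symm
  inner_inj i j i' j' h0 h1 h0' h1' hp := by
    obtain ⟨rfl, hj⟩ := h.inner_inj i _ i' _ (by omega) (by omega) (by omega) (by omega) hp
    exact ⟨rfl, by omega⟩
  edge_inj i j i' j' h1 h1' hp := by
    obtain ⟨rfl, hj⟩ := h.edge_inj i _ i' _ (by omega) (by omega) hp
    exact ⟨rfl, by omega⟩
  isLink i j hj := by
    have hl := (h.isLink i (len i - 1 - j) (by omega)).symm
    rw [show len i - 1 - j + 1 = len i - j by omega] at hl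
    rwa [show len i - (j + 1) = len i - 1 - j by omega]
  vertexSet_eq := by
    rw [h.vertexSet_eq]
    ext x
    constructor
    · rintro ⟨i, j, hj, rfl⟩
      exact ⟨i, len i - j, by omega, by congr 1; omega⟩
    · rintro ⟨i, j, hj, rfl⟩
      exact ⟨i, len i - j, by omega, rfl⟩
  edgeSet_eq := by
    rw [h.edgeSet_eq]
    ext x
    constructor
    · rintro ⟨i, j, hj, rfl⟩
      exact ⟨i, len i - 1 - j, by omega, by congr 1; omega⟩
    · rintro ⟨i, j, hj, rfl⟩
      exact ⟨i, len i - 1 - j, by omega, rfl⟩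

open Classical in
/-- A set of vertices is counted path by path. -/
theorem card_eq (h : G.IsParallelCompositionOfPaths s t k len p e) {U : Finset α}
    (hU : ∀ x ∈ U, x ∈ G.vertexSet) :
    U.card = (if s ∈ U then 1 else 0) + (if t ∈ U then 1 else 0) +
      ∑ i, ((Finset.Ioo 0 (len i)).filter (fun j => p i j ∈ U)).card := by
  have key : U = (({s} : Finset α).filter (· ∈ U) ∪ ({t} : Finset α).filter (· ∈ U)) ∪
      (Finset.univ.sigma fun i => (Finset.Ioo 0 (len i)).filter (fun j => p i j ∈ U)).image
        (fun q => p q.1 q.2) := by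
    ext x
    simp only [Finset.mem_union, Finset.mem_filter, Finset.mem_singleton, Finset.mem_image,
      Finset.mem_sigma, Finset.mem_univ, true_and, Finset.mem_Ioo, Sigma.exists]
    constructor
    · intro hx
      rcases h.mem_vertexSet_iff.1 (hU x hx) with rfl | rfl | ⟨i, j, h0, h1, rfl⟩
      · exact Or.inl (Or.inl ⟨rfl, hx⟩)
      · exact Or.inl (Or.inr ⟨rfl, hx⟩)
      · exact Or.inr ⟨i, j, ⟨⟨h0, h1⟩, hx⟩, rfl⟩
    · rintro ((⟨_, hx⟩ | ⟨_, hx⟩) | ⟨i, j, ⟨_, hx⟩, rfl⟩) <;> exact hx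
  conv_lhs => rw [key]
  rw [Finset.card_union_of_disjoint, Finset.card_union_of_disjoint, Finset.card_image_of_injOn,
    Finset.card_sigma, Finset.filter_singleton, Finset.filter_singleton]
  · split_ifs <;> rfl
  · rintro ⟨i, j⟩ hq ⟨i', j'⟩ hq' hp
    simp only [Finset.coe_sigma, Set.mem_sigma_iff, Finset.mem_coe, Finset.mem_filter,
      Finset.mem_Ioo] at hq hq'
    obtain ⟨rfl, rfl⟩ := h.inner_inj i j i' j' hq.2.1.1 hq.2.1.2 hq'.2.1.1 hq'.2.1.2 hp
    rfl
  · rw [Finset.disjoint_left]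
    intro x hx hx'
    simp only [Finset.mem_filter, Finset.mem_singleton] at hx hx'
    exact h.source_ne_sink (hx.1.symm.trans hx'.1)
  · rw [Finset.disjoint_left]
    intro x hx hx'
    simp only [Finset.mem_union, Finset.mem_filter, Finset.mem_singleton, Finset.mem_image,
      Finset.mem_sigma, Finset.mem_univ, true_and, Finset.mem_Ioo, Sigma.exists] at hx hx'
    obtain ⟨i, j, ⟨⟨h0, h1⟩, _⟩, rfl⟩ := hx'
    have := h.inner_ne i j h0 h1
    tauto

theorem finite_vertexSet (h : G.IsParallelCompositionOfPaths s t k len p e) :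
    G.vertexSet.Finite := by
  have : G.vertexSet ⊆ ⋃ i, (fun j => p i j) '' Set.Iic (len i) := by
    rw [h.vertexSet_eq]
    rintro x ⟨i, j, hj, rfl⟩
    exact Set.mem_iUnion.2 ⟨i, j, hj, rfl⟩
  exact (Set.finite_iUnion fun i => (Set.finite_Iic _).image _).subset this

theorem ncard_vertexSet (h : G.IsParallelCompositionOfPaths s t k len p e) :
    G.vertexSet.ncard = 2 + ∑ i, (len i - 1) := by
  classical
  rw [Set.ncard_eq_toFinset_card _ h.finite_vertexSet, h.card_eq (by simp), if_pos, if_pos]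
  · congr 1
    refine Finset.sum_congr rfl fun i _ => ?_
    rw [Finset.filter_true_of_mem, Nat.card_Ioo, Nat.sub_zero]
    intro j hj
    simpa using h.mem_vertexSet (Finset.mem_Ioo.1 hj).2.le
  · simpa using h.mem_vertexSet_iff.2 (Or.inr (Or.inl rfl))
  · simpa using h.mem_vertexSet_iff.2 (Or.inl rfl)

/-- The first edges of the paths are distinct. This turns bounds in `k` into bounds in the number of
edges. -/
theorem le_ncard_edgeSet (h : G.IsParallelCompositionOfPaths s t k len p e) :
    k ≤ G.edgeSet.ncard := by
  have hfin : G.edgeSet.Finite := by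
    have : G.edgeSet ⊆ ⋃ i, (fun j => e i j) '' Set.Iio (len i) := by
      rw [h.edgeSet_eq]
      rintro x ⟨i, j, hj, rfl⟩
      exact Set.mem_iUnion.2 ⟨i, j, hj, rfl⟩
    exact (Set.finite_iUnion fun i => (Set.finite_Iio _).image _).subset this
  have hinj : Function.Injective fun i => e i 0 := fun i i' hi =>
    (h.edge_inj i 0 i' 0 (h.one_le_len i) (h.one_le_len i') hi).1
  calc k = (Set.range fun i => e i 0).ncard := by
        rw [Set.ncard_range_of_injective hinj]; simp
    _ ≤ _ := Set.ncard_le_ncard (by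
        rintro _ ⟨i, rfl⟩
        rw [h.edgeSet_eq]
        exact ⟨i, 0, h.one_le_len i, rfl⟩) hfin

end IsParallelCompositionOfPaths

/-! ### The number of guards on a path -/

open Classical in
/-- A set that meets every two successive numbers contains half the numbers. -/
theorem half_le_card_filter_Ico (g : ℕ → Prop) (a n : ℕ)
    (hg : ∀ j, a ≤ j → j + 1 < a + n → g j ∨ g (j + 1)) :
    n / 2 ≤ ((Finset.Ico a (a + n)).filter g).card := by
  induction n using Nat.twoStepInduction with
  | zero => simp
  | one => simp
  | more n ih _ =>
    have h1 := ih fun j hj hj' => hg j hj (by omega)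
    have h2 : 1 ≤ ((Finset.Ico (a + n) (a + (n + 2))).filter g).card := by
      rw [Nat.one_le_iff_ne_zero, Finset.card_ne_zero]
      rcases hg (a + n) (by omega) (by omega) with h | h
      · exact ⟨a + n, by simp [h]⟩
      · exact ⟨a + n + 1, by simp [h]; omega⟩
    rw [← Finset.Ico_union_Ico_eq_Ico (Nat.le_add_right a n)
      (show a + n ≤ a + (n + 2) by omega), Finset.filter_union, Finset.card_union_of_disjoint
      (Finset.disjoint_filter_filter (Finset.Ico_disjoint_Ico_consecutive _ _ _))]
    omega

namespace IsParallelCompositionOfPaths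

variable {α β : Type*} {G : Graph α β} {s t : α} {k : ℕ} {len : Fin k → ℕ} {p : Fin k → ℕ → α}
  {e : Fin k → ℕ → β} {U : Finset α}

open Classical in
/-- The guards of `U` in the interior of the `i`-th path. -/
noncomputable def innerGuards (len : Fin k → ℕ) (p : Fin k → ℕ → α) (U : Finset α) (i : Fin k) :
    Finset ℕ :=
  (Finset.Ioo 0 (len i)).filter fun j => p i j ∈ U

theorem cover_apply (h : G.IsParallelCompositionOfPaths s t k len p e) (hU : G.IsVertexCover U)
    (i : Fin k) {j : ℕ} (hj : j < len i) : p i j ∈ U ∨ p i (j + 1) ∈ U :=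
  hU.2 _ _ _ (h.isLink i j hj)

/-- Stated for part of the interior, so that positions near the ends whose guard is forced can be
split off and counted separately. -/
theorem half_le_card_filter (h : G.IsParallelCompositionOfPaths s t k len p e)
    (hU : G.IsVertexCover U) {i : Fin k} {a b : ℕ} (ha : 0 < a) (hb : b ≤ len i) :
    (b - a) / 2 ≤ (innerGuards len p U i ∩ Finset.Ico a b).card := by
  classical
  rcases le_or_gt b a with hab | hab
  · simp [Nat.sub_eq_zero_of_le hab]
  refine (half_le_card_filter_Ico (fun j => p i j ∈ U) a (b - a) fun j _ hj =>
    h.cover_apply hU i (by omega)).trans (Finset.card_le_card fun j hj => ?_)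
  simp only [Finset.mem_filter, Finset.mem_Ico, innerGuards, Finset.mem_inter,
    Finset.mem_Ioo] at hj ⊢
  exact ⟨⟨⟨by omega, by omega⟩, hj.2⟩, by omega, by omega⟩

theorem half_pred_le_card_innerGuards (h : G.IsParallelCompositionOfPaths s t k len p e)
    (hU : G.IsVertexCover U) (i : Fin k) : (len i - 1) / 2 ≤ (innerGuards len p U i).card :=
  (h.half_le_card_filter hU one_pos le_rfl).trans (Finset.card_le_card Finset.inter_subset_left)

theorem mem_innerGuards {i : Fin k} {j : ℕ} :
    j ∈ innerGuards len p U i ↔ (0 < j ∧ j < len i) ∧ p i j ∈ U := by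
  simp [innerGuards]

theorem half_le_card_innerGuards_of_one_mem (h : G.IsParallelCompositionOfPaths s t k len p e)
    (hU : G.IsVertexCover U) {i : Fin k} (hi : 2 ≤ len i) (h1 : p i 1 ∈ U) :
    len i / 2 ≤ (innerGuards len p U i).card := by
  have h2 := h.half_le_card_filter hU (i := i) (a := 2) (b := len i) two_pos le_rfl
  have h3 : innerGuards len p U i ∩ Finset.Ico 2 (len i) ⊂ innerGuards len p U i :=
    (Finset.ssubset_iff_of_subset Finset.inter_subset_left).2
      ⟨1, mem_innerGuards.2 ⟨⟨one_pos, hi⟩, h1⟩, by simp⟩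
  have := Finset.card_lt_card h3
  omega

/-- With `s` unguarded, the first edge forces a guard at position 1. A path of length 1 has no
interior, and the bound is 0. -/
theorem half_le_card_innerGuards_of_source (h : G.IsParallelCompositionOfPaths s t k len p e)
    (hU : G.IsVertexCover U) (hs : s ∉ U) (i : Fin k) :
    len i / 2 ≤ (innerGuards len p U i).card := by
  rcases (h.one_le_len i).eq_or_lt with h1 | h1
  · rw [← h1]; exact Nat.zero_le _
  · refine h.half_le_card_innerGuards_of_one_mem hU h1 ?_
    have := h.cover_apply hU i (h.one_le_len i)
    rw [h.first] at this
    exact this.resolve_left hs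

theorem half_le_card_innerGuards_of_sink (h : G.IsParallelCompositionOfPaths s t k len p e)
    (hU : G.IsVertexCover U) (ht : t ∉ U) (i : Fin k) :
    len i / 2 ≤ (innerGuards len p U i).card := by
  rcases (h.one_le_len i).eq_or_lt with h1 | h1
  · rw [← h1]; exact Nat.zero_le _
  · have h2 := h.half_le_card_filter hU (i := i) (a := 1) (b := len i - 1) one_pos (by omega)
    have h4 := h.cover_apply hU i (j := len i - 1) (by omega)
    rw [show len i - 1 + 1 = len i by omega, h.last] at h4
    have h3 : innerGuards len p U i ∩ Finset.Ico 1 (len i - 1) ⊂ innerGuards len p U i :=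
      (Finset.ssubset_iff_of_subset Finset.inter_subset_left).2
        ⟨len i - 1, mem_innerGuards.2 ⟨⟨by omega, by omega⟩, h4.resolve_right ht⟩, by simp⟩
    have := Finset.card_lt_card h3
    omega

/-- Guards are forced at positions 1 and `len i - 1`. Length 1 would leave an edge uncovered, for
length 2 the two positions coincide, and otherwise `len i - 3` positions remain between them. -/
theorem half_succ_le_card_innerGuards (h : G.IsParallelCompositionOfPaths s t k len p e)
    (hU : G.IsVertexCover U) (hs : s ∉ U) (ht : t ∉ U) (i : Fin k) :
    (len i + 1) / 2 ≤ (innerGuards len p U i).card := by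
  have hl := h.one_le_len i
  have h5 := h.cover_apply hU i hl
  have h4 := h.cover_apply hU i (j := len i - 1) (by omega)
  rw [show len i - 1 + 1 = len i by omega, h.last] at h4
  rw [h.first] at h5
  replace h4 := h4.resolve_right ht
  replace h5 := h5.resolve_left hs
  have hne : len i ≠ 1 := fun h1 => ht (by rwa [zero_add, ← h1, h.last] at h5)
  rcases eq_or_ne (len i) 2 with h2 | h2
  · have := h.half_le_card_innerGuards_of_source hU hs i
    rw [h2] at this ⊢
    exact this
  have h2 := h.half_le_card_filter hU (i := i) (a := 2) (b := len i - 1) two_pos (by omega)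
  have h3 : insert 1 (insert (len i - 1) (innerGuards len p U i ∩ Finset.Ico 2 (len i - 1))) ⊆
      innerGuards len p U i := by
    simp only [Finset.insert_subset_iff]
    exact ⟨mem_innerGuards.2 ⟨⟨one_pos, by omega⟩, h5⟩,
      mem_innerGuards.2 ⟨⟨by omega, by omega⟩, h4⟩, Finset.inter_subset_left⟩
  have := Finset.card_le_card h3
  rw [Finset.card_insert_of_notMem (by simp; omega), Finset.card_insert_of_notMem (by simp)] at this
  omega

/-- The number of paths of even length. -/
def evenCount (len : Fin k → ℕ) : ℕ := ∑ i, if len i % 2 = 0 then 1 else 0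

theorem sum_half_pred (hl : ∀ i, 1 ≤ len i) :
    ∑ i, (len i - 1) / 2 + evenCount len = ∑ i, len i / 2 := by
  rw [evenCount, ← Finset.sum_add_distrib]
  refine Finset.sum_congr rfl fun i _ => ?_
  have := hl i
  split_ifs <;> omega

/-- The interior of a path has `len i - 1` vertices, and `2 * (len i / 2)` exceeds this by one
exactly for even length. -/
theorem two_mul_sum_half (h : G.IsParallelCompositionOfPaths s t k len p e) :
    2 * ∑ i, len i / 2 + 2 = G.vertexSet.ncard + evenCount len := by
  rw [h.ncard_vertexSet, evenCount, Finset.mul_sum, add_comm _ 2, add_assoc,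
    ← Finset.sum_add_distrib]
  congr 1
  refine Finset.sum_congr rfl fun i _ => ?_
  have := h.one_le_len i
  split_ifs <;> omega

theorem evenCount_le (len : Fin k → ℕ) : evenCount len ≤ k := by
  calc evenCount len ≤ ∑ _i : Fin k, 1 := Finset.sum_le_sum fun i _ => by split_ifs <;> simp
    _ = k := by simp

/-- A set missing the source or the sink has at least this many members. -/
theorem le_card_of_not_both (h : G.IsParallelCompositionOfPaths s t k len p e)
    (hU : G.IsVertexCover U) (hst : ¬(s ∈ U ∧ t ∈ U)) :
    ∑ i, len i / 2 + 1 ≤ U.card ∨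
      (s ∉ U ∧ t ∉ U ∧ ∑ i, len i / 2 + k ≤ U.card + evenCount len) := by
  classical
  have hc := h.card_eq hU.1
  change _ = _ + ∑ i, (innerGuards len p U i).card at hc
  by_cases hs : s ∈ U
  · have ht : t ∉ U := fun ht => hst ⟨hs, ht⟩
    have := Finset.sum_le_sum fun i (_ : i ∈ Finset.univ) =>
      h.half_le_card_innerGuards_of_sink hU ht i
    rw [if_pos hs, if_neg ht] at hc
    omega
  by_cases ht : t ∈ U
  · have := Finset.sum_le_sum fun i (_ : i ∈ Finset.univ) =>
      h.half_le_card_innerGuards_of_source hU hs i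
    rw [if_pos ht, if_neg hs] at hc
    omega
  · refine Or.inr ⟨hs, ht, ?_⟩
    rw [if_neg hs, if_neg ht] at hc
    have h1 := Finset.sum_le_sum fun i (_ : i ∈ Finset.univ) =>
      h.half_succ_le_card_innerGuards hU hs ht i
    have h2 : ∑ i, (len i + 1) / 2 + evenCount len = ∑ i, len i / 2 + k := by
      have hk : ∑ i, len i / 2 + k = ∑ i, (len i / 2 + 1) := by simp [Finset.sum_add_distrib]
      rw [evenCount, hk, ← Finset.sum_add_distrib]
      refine Finset.sum_congr rfl fun i _ => ?_
      split_ifs <;> omega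
    omega

/-- Even with both ends guarded a path of odd length needs `len i / 2` inner guards; only a path of
even length saves one. -/
theorem le_card_of_both (h : G.IsParallelCompositionOfPaths s t k len p e)
    (hU : G.IsVertexCover U) (hs : s ∈ U) (ht : t ∈ U) :
    ∑ i, len i / 2 + 2 ≤ U.card + evenCount len := by
  classical
  have hc := h.card_eq hU.1
  change _ = _ + ∑ i, (innerGuards len p U i).card at hc
  have := Finset.sum_le_sum fun i (_ : i ∈ Finset.univ) => h.half_pred_le_card_innerGuards hU i
  have := sum_half_pred h.one_le_len
  rw [if_pos hs, if_pos ht] at hc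
  omega

/-- A guard next to the source on a path of even length is not economical. -/
theorem le_card_of_one_mem (h : G.IsParallelCompositionOfPaths s t k len p e)
    (hU : G.IsVertexCover U) (hs : s ∈ U) (ht : t ∈ U) {i : Fin k} (hi : len i % 2 = 0)
    (h1 : p i 1 ∈ U) : ∑ i, len i / 2 + 3 ≤ U.card + evenCount len := by
  classical
  have hc := h.card_eq hU.1
  change _ = _ + ∑ i, (innerGuards len p U i).card at hc
  have hl := h.one_le_len i
  -- A guard at position 1 costs the even path `i` the guard it could have saved, so the inequality
  -- of sums is strict.
  have := Finset.sum_lt_sum (fun i (_ : i ∈ Finset.univ) => h.half_pred_le_card_innerGuards hU i)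
    ⟨i, Finset.mem_univ i, by
      have := h.half_le_card_innerGuards_of_one_mem hU (by omega) h1
      omega⟩
  have := sum_half_pred h.one_le_len
  rw [if_pos hs, if_pos ht] at hc
  omega

theorem exists_even (hk : 1 ≤ evenCount len) : ∃ i, len i % 2 = 0 := by
  by_contra hne
  push Not at hne
  have : evenCount len = 0 := Finset.sum_eq_zero fun i _ => if_neg (hne i)
  omega

/-! ### Lower bounds -/

/-- In a class of minimum size for which every member holds the source and the sink, the first
edge of a path of even length cannot be defended. -/
theorem le_of_forall_both (h : G.IsParallelCompositionOfPaths s t k len p e)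
    {𝒰 : Set (Finset α)} (h𝒰 : G.IsEternalVertexCoverClass 𝒰) {m : ℕ}
    (hm : ∀ U ∈ 𝒰, U.card = m) (hst : ∀ U ∈ 𝒰, s ∈ U ∧ t ∈ U) (hk : 1 ≤ evenCount len) :
    ∑ i, len i / 2 + 3 ≤ m + evenCount len := by
  by_contra hlt
  obtain ⟨i, hi⟩ := exists_even hk
  have hno : ∀ U ∈ 𝒰, p i 1 ∉ U := fun U hU h1 => by
    have := h.le_card_of_one_mem (h𝒰.2.1 U hU) (hst U hU).1 (hst U hU).2 hi h1
    rw [hm U hU] at this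
    omega
  obtain ⟨U, hU⟩ := h𝒰.1
  have hlink := h.isLink i 0 (h.one_le_len i)
  obtain ⟨U', hU', φ, hφ, -, x, hx, hxe⟩ := h𝒰.2.2.2 U hU _ hlink.edge_mem
  -- The guard that crosses the edge ends or starts at position 1, so `U'` or `U` has a guard there.
  rcases hxe.eq_and_eq_or_eq_and_eq hlink with ⟨-, h1⟩ | ⟨rfl, -⟩
  · exact hno U' hU' (by simpa [← h1] using hφ.mapsTo hx)
  · exact hno U hU (by simpa using hx)

/-- Truncated subtraction joins two regimes, `H + 1` for `q ≤ 2` and `H + 3 - q` beyond, where `H =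
∑ i, len i / 2` and `q = evenCount len`. As `k ≥ 3`, a cover missing an end is already this large,
so a smaller class would keep both ends guarded throughout. -/
theorem le_of_three_le (h : G.IsParallelCompositionOfPaths s t k len p e) (hk : 3 ≤ k)
    {m : ℕ} (hm : m ∈ G.eternalVertexCoverSizes) :
    ∑ i, len i / 2 + 1 ≤ m + (evenCount len - 2) := by
  obtain ⟨𝒰, h𝒰, hm⟩ := hm
  by_contra hlt
  have hst : ∀ U ∈ 𝒰, s ∈ U ∧ t ∈ U := by
    intro U hU
    by_contra hst
    have h1 := h.le_card_of_not_both (h𝒰.2.1 U hU) hst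
    rw [hm U hU] at h1
    have := evenCount_le len
    omega
  obtain ⟨U, hU⟩ := h𝒰.1
  have h2 := h.le_card_of_both (h𝒰.2.1 U hU) (hst U hU).1 (hst U hU).2
  rw [hm U hU] at h2
  have := h.le_of_forall_both h𝒰 hm hst (by omega)
  omega

/-- Here the bounds for a single vertex cover suffice; no attack is needed. -/
theorem le_of_two_le (h : G.IsParallelCompositionOfPaths s t k len p e) (hk : 2 ≤ k)
    (hk' : evenCount len ≤ 2) {m : ℕ} (hm : m ∈ G.eternalVertexCoverSizes) :
    ∑ i, len i / 2 + 1 ≤ m + (evenCount len - 1) := by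
  obtain ⟨𝒰, h𝒰, hm⟩ := hm
  obtain ⟨U, hU⟩ := h𝒰.1
  have hc := h𝒰.2.1 U hU
  rw [← hm U hU]
  by_cases hst : s ∈ U ∧ t ∈ U
  · have := h.le_card_of_both hc hst.1 hst.2
    omega
  · have := h.le_card_of_not_both hc hst
    omega

/-- On a path, all vertices but one are needed. -/
theorem le_of_eq_one {len : Fin 1 → ℕ} {p : Fin 1 → ℕ → α} {e : Fin 1 → ℕ → β}
    (h : G.IsParallelCompositionOfPaths s t 1 len p e) {m : ℕ}
    (hm : m ∈ G.eternalVertexCoverSizes) : len 0 ≤ m := by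
  classical
  obtain ⟨𝒰, h𝒰, hm⟩ := hm
  -- Attacking the edge after the guarded initial segment makes this segment grow until only the
  -- last vertex may be free.
  have hex : ∀ n ≤ len 0, ∃ U ∈ 𝒰, ∀ j < n, p 0 j ∈ U := by
    intro n
    induction n with
    | zero => exact fun _ => h𝒰.1.imp fun U hU => ⟨hU, by simp⟩
    | succ n ih =>
      intro hn
      obtain ⟨U, hU, hpre⟩ := ih (by omega)
      by_cases hnU : p 0 n ∈ U
      · exact ⟨U, hU, fun j hj => (Nat.lt_succ_iff_lt_or_eq.1 hj).elim (hpre j) (· ▸ hnU)⟩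
      have hnU' : p 0 (n + 1) ∈ U :=
        (h.cover_apply (h𝒰.2.1 U hU) 0 (j := n) (by omega)).resolve_left hnU
      have hlink := h.isLink 0 n (by omega)
      obtain ⟨U', hU', φ, hφ, hmove, x, hx, hxe⟩ := h𝒰.2.2.2 U hU _ hlink.edge_mem
      rcases hxe.eq_and_eq_or_eq_and_eq hlink with ⟨rfl, -⟩ | ⟨rfl, hx'⟩
      · exact absurd hx hnU
      refine ⟨U', hU', ?_⟩
      -- `S` consists of the `n + 1` guards on the initial segment and at position `n + 1`. The last
      -- one moves to `n` and the others cannot pass `n`, so they are mapped injectively into the `n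
      -- + 1` vertices of `T` and fill it.
      let S : Finset α := (insert (n + 1) (Finset.range n)).image (p 0)
      let T : Finset α := (Finset.range (n + 1)).image (p 0)
      have hS : S.card = n + 1 := by
        rw [Finset.card_image_of_injOn, Finset.card_insert_of_notMem (by simp), Finset.card_range]
        intro a ha b hb hab
        simp only [Finset.coe_insert, Finset.coe_range, Set.mem_insert_iff, Set.mem_Iio] at ha hb
        exact h.apply_injective (by omega) (by omega) hab
      have hSU : S ⊆ U := by
        intro y hy
        simp only [S, Finset.mem_image, Finset.mem_insert, Finset.mem_range] at hy
        obtain ⟨j, rfl | hj, rfl⟩ := hy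
        · exact hx
        · exact hpre j hj
      have hmaps : Set.MapsTo φ S T := by
        intro y hy
        simp only [S, Finset.coe_image, Finset.coe_insert, Finset.coe_range, Set.mem_image,
          Set.mem_insert_iff, Set.mem_Iio] at hy
        simp only [T, Finset.coe_image, Finset.coe_range, Set.mem_image, Set.mem_Iio]
        obtain ⟨j, rfl | hj, rfl⟩ := hy
        · exact ⟨n, by omega, hx'.symm⟩
        · rcases hmove _ (hpre j hj) with h1 | ⟨f, hf⟩
          · exact ⟨j, by omega, h1.symm⟩
          · obtain ⟨i, j', hj', -, h1⟩ := h.isLink_iff.1 hf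
            obtain rfl := Subsingleton.elim i 0
            rcases h1 with ⟨h1, h2⟩ | ⟨h1, h2⟩
            · have := h.apply_injective (by omega) (by omega) h1
              exact ⟨j' + 1, by omega, h2.symm⟩
            · have := h.apply_injective (by omega) (by omega) h1
              exact ⟨j', by omega, h2.symm⟩
      have hsurj := Finset.surjOn_of_injOn_of_card_le φ hmaps
        (hφ.injOn.mono (Finset.coe_subset.2 hSU))
        (by rw [hS]; exact Finset.card_image_le.trans (by simp))
      intro j hj
      obtain ⟨y, hy, hyj⟩ := hsurj (show p 0 j ∈ (T : Set α) by
        simp only [T, Finset.coe_image, Finset.coe_range, Set.mem_image, Set.mem_Iio]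
        exact ⟨j, hj, rfl⟩)
      exact hyj ▸ hφ.mapsTo (hSU hy)
  obtain ⟨U, hU, hpre⟩ := hex _ le_rfl
  rw [← hm U hU]
  have hsub : (Finset.range (len 0)).image (p 0) ⊆ U := by
    intro y hy
    simp only [Finset.mem_image, Finset.mem_range] at hy
    obtain ⟨j, hj, rfl⟩ := hy
    exact hpre j hj
  have := Finset.card_le_card hsub
  rwa [Finset.card_image_of_injOn, Finset.card_range] at this
  intro a ha b hb hab
  simp only [Finset.coe_range, Set.mem_Iio] at ha hb
  exact h.apply_injective ha.le hb.le hab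

end IsParallelCompositionOfPaths
end Graph

namespace Graph

/-! ### Strategies in which the guards of each path stand at alternate positions -/

/-- A placement of guards on a melon graph: whether the source and the sink are guarded, and for
each path the parity of the guarded inner positions. -/
@[ext]
structure Placement (k : ℕ) where
  source : Prop
  sink : Prop
  parity : Fin k → ℕ

namespace Placement

variable {k : ℕ}

/-- When the guards of the `i`-th path shift by `d i`, a guard leaves the source along it. -/
def LeavesSource (X : Placement k) (d : Fin k → ℤ) (i : Fin k) : Prop :=
  d i = 1 ∧ X.parity i % 2 = 0

/-- When the guards of the `i`-th path shift by `d i`, a guard enters the source along it. -/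
def EntersSource (X : Placement k) (d : Fin k → ℤ) (i : Fin k) : Prop :=
  d i = -1 ∧ X.parity i % 2 = 1

/-- When the guards of the `i`-th path shift by `d i`, a guard leaves the sink along it. -/
def LeavesSink (len : Fin k → ℕ) (X : Placement k) (d : Fin k → ℤ) (i : Fin k) : Prop :=
  d i = -1 ∧ (len i + X.parity i) % 2 = 0

/-- When the guards of the `i`-th path shift by `d i`, a guard enters the sink along it. -/
def EntersSink (len : Fin k → ℕ) (X : Placement k) (d : Fin k → ℤ) (i : Fin k) : Prop :=
  d i = 1 ∧ (len i + X.parity i) % 2 = 1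

/-- Shifting the guards of the `i`-th path by `d i` leads from `X` to `Y`. -/
structure IsMove (len : Fin k → ℕ) (X Y : Placement k) (d : Fin k → ℤ) : Prop where
  range : ∀ i, d i = -1 ∨ d i = 0 ∨ d i = 1
  parity : ∀ i, ((Y.parity i : ℤ) - X.parity i - d i) % 2 = 0
  source_of_leaves : ∀ i, X.LeavesSource d i → X.source
  leavesSource_unique : ∀ i i', X.LeavesSource d i → X.LeavesSource d i' → i = i'
  source_of_enters : ∀ i, X.EntersSource d i → Y.source ∧ (X.source → ∃ i', X.LeavesSource d i')
  entersSource_unique : ∀ i i', X.EntersSource d i → X.EntersSource d i' → i = i'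
  source_stays : X.source → Y.source ∨ ∃ i, X.LeavesSource d i
  sink_of_leaves : ∀ i, X.LeavesSink len d i → X.sink
  leavesSink_unique : ∀ i i', X.LeavesSink len d i → X.LeavesSink len d i' → i = i'
  sink_of_enters : ∀ i, X.EntersSink len d i → Y.sink ∧ (X.sink → ∃ i', X.LeavesSink len d i')
  entersSink_unique : ∀ i i', X.EntersSink len d i → X.EntersSink len d i' → i = i'
  sink_stays : X.sink → Y.sink ∨ ∃ i, X.LeavesSink len d i

/-- Every edge of the melon graph has a guarded end. -/
structure Covers (len : Fin k → ℕ) (X : Placement k) : Prop where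
  source : ¬X.source → ∀ i, X.parity i % 2 = 1
  sink : ¬X.sink → ∀ i, (len i + X.parity i) % 2 = 1
  both : ¬X.source → ¬X.sink → ∀ i, len i ≠ 1

open Classical in
/-- The number of guards, up to a constant depending on the graph. -/
noncomputable def deficit (len : Fin k → ℕ) (X : Placement k) : ℕ :=
  ∑ i, if len i % 2 = 0 ∧ X.parity i % 2 = 0 then 1 else 0

end Placement

/-! ### Placements and their moves realised by guards on vertices -/

namespace IsParallelCompositionOfPaths

open Placement

variable {α β : Type*} {G : Graph α β} {s t : α} {k : ℕ} {len : Fin k → ℕ} {p : Fin k → ℕ → α}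
  {e : Fin k → ℕ → β}

open Classical in
/-- The set of guarded vertices. -/
noncomputable def guards (h : G.IsParallelCompositionOfPaths s t k len p e) (X : Placement k) :
    Finset α :=
  h.finite_vertexSet.toFinset.filter fun x =>
    (x = s ∧ X.source) ∨ (x = t ∧ X.sink) ∨
      ∃ i j, 0 < j ∧ j < len i ∧ (j + X.parity i) % 2 = 0 ∧ x = p i j

theorem mem_guards (h : G.IsParallelCompositionOfPaths s t k len p e) {X : Placement k} {x : α} :
    x ∈ h.guards X ↔ (x = s ∧ X.source) ∨ (x = t ∧ X.sink) ∨
      ∃ i j, 0 < j ∧ j < len i ∧ (j + X.parity i) % 2 = 0 ∧ x = p i j := by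
  simp only [guards, Finset.mem_filter, Set.Finite.mem_toFinset, and_iff_right_iff_imp]
  rintro (⟨rfl, -⟩ | ⟨rfl, -⟩ | ⟨i, j, _, hj, -, rfl⟩)
  · exact h.mem_vertexSet_iff.2 (Or.inl rfl)
  · exact h.mem_vertexSet_iff.2 (Or.inr (Or.inl rfl))
  · exact h.mem_vertexSet hj.le

theorem source_mem_guards (h : G.IsParallelCompositionOfPaths s t k len p e) {X : Placement k} :
    s ∈ h.guards X ↔ X.source := by
  rw [h.mem_guards]
  constructor
  · rintro (⟨-, hs⟩ | ⟨hs, -⟩ | ⟨i, j, h0, h1, -, hs⟩)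
    · exact hs
    · exact absurd hs h.source_ne_sink
    · exact absurd hs.symm (h.inner_ne i j h0 h1).1
  · exact fun hs => Or.inl ⟨rfl, hs⟩

theorem sink_mem_guards (h : G.IsParallelCompositionOfPaths s t k len p e) {X : Placement k} :
    t ∈ h.guards X ↔ X.sink := by
  rw [h.mem_guards]
  constructor
  · rintro (⟨hs, -⟩ | ⟨-, hs⟩ | ⟨i, j, h0, h1, -, hs⟩)
    · exact absurd hs.symm h.source_ne_sink
    · exact hs
    · exact absurd hs.symm (h.inner_ne i j h0 h1).2
  · exact fun hs => Or.inr (Or.inl ⟨rfl, hs⟩)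

theorem inner_mem_guards (h : G.IsParallelCompositionOfPaths s t k len p e) {X : Placement k}
    {i : Fin k} {j : ℕ} (h0 : 0 < j) (h1 : j < len i) :
    p i j ∈ h.guards X ↔ (j + X.parity i) % 2 = 0 := by
  rw [h.mem_guards]
  constructor
  · rintro (⟨hs, -⟩ | ⟨hs, -⟩ | ⟨i', j', h0', h1', h2, hs⟩)
    · exact absurd hs (h.inner_ne i j h0 h1).1
    · exact absurd hs (h.inner_ne i j h0 h1).2
    · obtain ⟨rfl, rfl⟩ := h.inner_inj _ _ _ _ h0 h1 h0' h1' hs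
      exact h2
  · exact fun hs => Or.inr (Or.inr ⟨i, j, h0, h1, hs, rfl⟩)

/-- Of two successive inner positions one has the guarded parity; only the first and the last edge
of a path need the conditions of `Covers`. -/
theorem isVertexCover_guards (h : G.IsParallelCompositionOfPaths s t k len p e) {X : Placement k}
    (hX : X.Covers len) : G.IsVertexCover (h.guards X) := by
  classical
  have key : ∀ i j, j < len i → p i j ∈ h.guards X ∨ p i (j + 1) ∈ h.guards X := by
    intro i j hj
    rcases Nat.eq_zero_or_pos j with rfl | h0
    · rw [h.first, h.source_mem_guards]
      by_cases hs : X.source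
      · exact Or.inl hs
      have h1 := hX.source hs i
      rcases (h.one_le_len i).eq_or_lt with hl | hl
      · rw [zero_add, hl, h.last, h.sink_mem_guards]
        by_contra hcon
        exact hX.both hs (fun ht => hcon (Or.inr ht)) i hl.symm
      · rw [h.inner_mem_guards (by omega) (by omega)]
        omega
    · rw [h.inner_mem_guards h0 hj]
      rcases (show j + 1 ≤ len i from hj).eq_or_lt with hl | hl
      · rw [hl, h.last, h.sink_mem_guards]
        by_cases ht : X.sink
        · exact Or.inr ht
        · have := hX.sink ht i
          omega
      · rw [h.inner_mem_guards (by omega) hl]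
        omega
  refine ⟨fun x hx => ?_, fun f x y hf => ?_⟩
  · simp only [guards, Finset.mem_filter, Set.Finite.mem_toFinset] at hx
    exact hx.1
  · obtain ⟨i, j, hj, rfl, ⟨rfl, rfl⟩ | ⟨rfl, rfl⟩⟩ := h.isLink_iff.1 hf
    · exact key i j hj
    · exact (key i j hj).symm

theorem card_filter_parity (n c : ℕ) (hn : 1 ≤ n) :
    ((Finset.Ioo 0 n).filter fun j => (j + c) % 2 = 0).card = (n - 1 + c % 2) / 2 := by
  induction n, hn using Nat.le_induction with
  | base => simp; omega
  | succ n hn ih =>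
    have hI : Finset.Ioo 0 (n + 1) = insert n (Finset.Ioo 0 n) := by
      ext; simp; omega
    rw [hI, Finset.filter_insert]
    split_ifs with hc
    · rw [Finset.card_insert_of_notMem (by simp), ih]
      omega
    · rw [ih]
      omega

-- A path of odd length has `len i / 2` inner guards for either parity. One of even length has as
-- many for odd parity and one fewer for even parity, which `deficit` counts.
open Classical in
theorem card_guards (h : G.IsParallelCompositionOfPaths s t k len p e) (X : Placement k) :
    (h.guards X).card + X.deficit len =
      (if X.source then 1 else 0) + (if X.sink then 1 else 0) + ∑ i, len i / 2 := by
  rw [h.card_eq fun x hx => by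
    simp only [guards, Finset.mem_filter, Set.Finite.mem_toFinset] at hx; exact hx.1]
  simp only [h.source_mem_guards, h.sink_mem_guards]
  rw [add_assoc, deficit, ← Finset.sum_add_distrib]
  congr 1
  refine Finset.sum_congr rfl fun i _ => ?_
  have hl := h.one_le_len i
  rw [Finset.filter_congr fun j hj => h.inner_mem_guards (Finset.mem_Ioo.1 hj).1
    (Finset.mem_Ioo.1 hj).2, card_filter_parity _ _ hl]
  split_ifs <;> omega

/-- `x` is a guarded vertex whose guard goes to `y`. -/
def Goes (s t : α) (len : Fin k → ℕ) (p : Fin k → ℕ → α) (X : Placement k) (d : Fin k → ℤ)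
    (x y : α) : Prop :=
  (x = s ∧ y = s ∧ X.source ∧ ∀ i, ¬X.LeavesSource d i) ∨
  (x = t ∧ y = t ∧ X.sink ∧ ∀ i, ¬X.LeavesSink len d i) ∨
  ∃ i j j', (j + X.parity i) % 2 = 0 ∧ j ≤ len i ∧ j' ≤ len i ∧ (j' : ℤ) = j + d i ∧
    (j = 0 → d i = 1) ∧ (j = len i → d i = -1) ∧ x = p i j ∧ y = p i j'

variable {X Y : Placement k} {d : Fin k → ℤ}

/-- A guard at an end either stays, and then leaves along no path, or leaves along the only path
that allows it. -/
theorem Goes.right_unique (h : G.IsParallelCompositionOfPaths s t k len p e)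
    (hd : IsMove len X Y d) {x y y' : α} (hy : Goes s t len p X d x y)
    (hy' : Goes s t len p X d x y') : y = y' := by
  rcases hy with ⟨rfl, rfl, -, hn⟩ | ⟨rfl, rfl, -, hn⟩ |
    ⟨i, j, l, h1, h2, h3, h4, h5, h6, rfl, rfl⟩
  · rcases hy' with ⟨-, rfl, -⟩ | ⟨h0, -⟩ | ⟨i, j, l, h1, h2, h3, h4, h5, h6, hx, rfl⟩
    · rfl
    · exact absurd h0 h.source_ne_sink
    · have := (h.apply_eq_source_iff h2).1 hx.symm
      exact absurd ⟨h5 this, by omega⟩ (hn i)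
  · rcases hy' with ⟨h0, -⟩ | ⟨-, rfl, -⟩ | ⟨i, j, l, h1, h2, h3, h4, h5, h6, hx, rfl⟩
    · exact absurd h0.symm h.source_ne_sink
    · rfl
    · have := (h.apply_eq_sink_iff h2).1 hx.symm
      exact absurd ⟨h6 this, by omega⟩ (hn i)
  · rcases hy' with ⟨hx, rfl, -, hn⟩ | ⟨hx, rfl, -, hn⟩ |
      ⟨i', j', l', h1', h2', h3', h4', h5', h6', hx, rfl⟩
    · have := (h.apply_eq_source_iff h2).1 hx
      exact absurd ⟨h5 this, by omega⟩ (hn i)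
    · have := (h.apply_eq_sink_iff h2).1 hx
      exact absurd ⟨h6 this, by omega⟩ (hn i)
    · rcases h.eq_cases h2 h2' hx with ⟨h7, h8⟩ | ⟨h7, h8⟩ | ⟨rfl, rfl, -⟩
      · obtain rfl := hd.leavesSource_unique i i' ⟨h5 h7, by omega⟩ ⟨h5' h8, by omega⟩
        congr 1
        omega
      · obtain rfl := hd.leavesSink_unique i i' ⟨h6 h7, by omega⟩ ⟨h6' h8, by omega⟩
        congr 1
        omega
      · congr 1
        omega

/-- Guards of different paths can meet only at `s` or `t`. At most one guard enters there, and only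
if the guard standing there leaves. -/
theorem Goes.left_unique (h : G.IsParallelCompositionOfPaths s t k len p e)
    (hd : IsMove len X Y d) {x x' y : α} (hx : Goes s t len p X d x y)
    (hx' : Goes s t len p X d x' y) : x = x' := by
  -- A guard reaching `s` along a path comes from position 1: the condition on `j = 0` excludes one
  -- that merely stays at position 0.
  have enterS : ∀ {i j l}, (j + X.parity i) % 2 = 0 → j ≤ len i → l ≤ len i → (l : ℤ) = j + d i →
      (j = 0 → d i = 1) → p i l = s → X.EntersSource d i ∧ j = 1 := by
    intro i j l h1 h2 h3 h4 h5 hy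
    have := (h.apply_eq_source_iff h3).1 hy
    have := hd.range i
    exact ⟨⟨by omega, by omega⟩, by omega⟩
  have enterT : ∀ {i j l}, (j + X.parity i) % 2 = 0 → j ≤ len i → l ≤ len i → (l : ℤ) = j + d i →
      (j = len i → d i = -1) → p i l = t → X.EntersSink len d i ∧ j + 1 = len i := by
    intro i j l h1 h2 h3 h4 h6 hy
    have := (h.apply_eq_sink_iff h3).1 hy
    have := hd.range i
    exact ⟨⟨by omega, by omega⟩, by omega⟩
  rcases hx with ⟨rfl, rfl, hs, hn⟩ | ⟨rfl, rfl, hs, hn⟩ |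
    ⟨i, j, l, h1, h2, h3, h4, h5, h6, rfl, rfl⟩
  · rcases hx' with ⟨rfl, -⟩ | ⟨-, h0, -⟩ | ⟨i, j, l, h1, h2, h3, h4, h5, h6, rfl, hy⟩
    · rfl
    · exact absurd h0 h.source_ne_sink
    · obtain ⟨i', hi'⟩ := (hd.source_of_enters i (enterS h1 h2 h3 h4 h5 hy.symm).1).2 hs
      exact absurd hi' (hn i')
  · rcases hx' with ⟨-, h0, -⟩ | ⟨rfl, -⟩ | ⟨i, j, l, h1, h2, h3, h4, h5, h6, rfl, hy⟩
    · exact absurd h0.symm h.source_ne_sink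
    · rfl
    · obtain ⟨i', hi'⟩ := (hd.sink_of_enters i (enterT h1 h2 h3 h4 h6 hy.symm).1).2 hs
      exact absurd hi' (hn i')
  · rcases hx' with ⟨rfl, hy, hs, hn⟩ | ⟨rfl, hy, hs, hn⟩ |
      ⟨i', j', l', h1', h2', h3', h4', h5', h6', rfl, hy⟩
    · obtain ⟨i', hi'⟩ := (hd.source_of_enters i (enterS h1 h2 h3 h4 h5 hy).1).2 hs
      exact absurd hi' (hn i')
    · obtain ⟨i', hi'⟩ := (hd.sink_of_enters i (enterT h1 h2 h3 h4 h6 hy).1).2 hs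
      exact absurd hi' (hn i')
    · rcases h.eq_cases h3 h3' hy with ⟨rfl, rfl⟩ | ⟨rfl, rfl⟩ | ⟨rfl, rfl, -⟩
      · obtain ⟨ha, rfl⟩ := enterS h1 h2 h3 h4 h5 (h.first i)
        obtain ⟨hb, rfl⟩ := enterS h1' h2' h3' h4' h5' (h.first i')
        rw [hd.entersSource_unique i i' ha hb]
      · obtain ⟨ha, hj⟩ := enterT h1 h2 h3 h4 h6 (h.last i)
        obtain ⟨hb, hj'⟩ := enterT h1' h2' h3' h4' h6' (h.last i')
        obtain rfl := hd.entersSink_unique i i' ha hb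
        congr 1
        omega
      · congr 1
        omega

theorem Goes.mem_guards (h : G.IsParallelCompositionOfPaths s t k len p e)
    (hd : IsMove len X Y d) {x y : α} (hx : Goes s t len p X d x y) : y ∈ h.guards Y := by
  rcases hx with ⟨rfl, rfl, hs, hn⟩ | ⟨rfl, rfl, hs, hn⟩ |
    ⟨i, j, l, h1, h2, h3, h4, h5, h6, rfl, rfl⟩
  · exact h.source_mem_guards.2 ((hd.source_stays hs).resolve_right fun ⟨i, hi⟩ => hn i hi)
  · exact h.sink_mem_guards.2 ((hd.sink_stays hs).resolve_right fun ⟨i, hi⟩ => hn i hi)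
  · have hr := hd.range i
    have hp := hd.parity i
    have hl := h.one_le_len i
    by_cases h0 : l = 0
    · rw [h0, h.first, h.source_mem_guards]
      exact (hd.source_of_enters i ⟨by omega, by omega⟩).1
    by_cases h7 : l = len i
    · rw [h7, h.last, h.sink_mem_guards]
      exact (hd.sink_of_enters i ⟨by omega, by omega⟩).1
    · rw [h.inner_mem_guards (by omega) (by omega)]
      omega

theorem Goes.eq_or_adj (h : G.IsParallelCompositionOfPaths s t k len p e)
    (hd : IsMove len X Y d) {x y : α} (hx : Goes s t len p X d x y) : y = x ∨ G.Adj x y := by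
  rcases hx with ⟨rfl, rfl, hs, hn⟩ | ⟨rfl, rfl, hs, hn⟩ |
    ⟨i, j, l, h1, h2, h3, h4, h5, h6, rfl, rfl⟩
  · exact Or.inl rfl
  · exact Or.inl rfl
  · rcases hd.range i with hr | hr | hr
    · obtain rfl : j = l + 1 := by omega
      exact Or.inr ⟨_, (h.isLink i l (by omega)).symm⟩
    · exact Or.inl (by congr 1; omega)
    · obtain rfl : l = j + 1 := by omega
      exact Or.inr ⟨_, h.isLink i j (by omega)⟩

theorem exists_goes (h : G.IsParallelCompositionOfPaths s t k len p e)
    (hd : IsMove len X Y d) {x : α} (hx : x ∈ h.guards X) : ∃ y, Goes s t len p X d x y := by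
  rcases h.mem_guards.1 hx with ⟨rfl, hs⟩ | ⟨rfl, hs⟩ | ⟨i, j, h0, h1, h2, rfl⟩
  · by_cases hn : ∃ i, X.LeavesSource d i
    · obtain ⟨i, hi, hp⟩ := hn
      exact ⟨p i 1, Or.inr (Or.inr ⟨i, 0, 1, by omega, by omega, h.one_le_len i, by omega,
        fun _ => hi, fun h0 => absurd h0.symm (Nat.one_le_iff_ne_zero.1 (h.one_le_len i)),
        (h.first i).symm, rfl⟩)⟩
    · exact ⟨_, Or.inl ⟨rfl, rfl, hs, fun i hi => hn ⟨i, hi⟩⟩⟩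
  · by_cases hn : ∃ i, X.LeavesSink len d i
    · obtain ⟨i, hi, hp⟩ := hn
      have hl := h.one_le_len i
      exact ⟨p i (len i - 1), Or.inr (Or.inr ⟨i, len i, len i - 1, by omega, by omega, by omega,
        by omega, by omega, fun _ => hi, (h.last i).symm, rfl⟩)⟩
    · exact ⟨_, Or.inr (Or.inl ⟨rfl, rfl, hs, fun i hi => hn ⟨i, hi⟩⟩)⟩
  · have hr := hd.range i
    exact ⟨p i (j + d i).toNat, Or.inr (Or.inr ⟨i, j, _, h2, h1.le, by omega, by omega, by omega,
      by omega, rfl, rfl⟩)⟩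

/-- A move of the guards defends the edges along which guards are shifted. -/
theorem exists_isDefense (h : G.IsParallelCompositionOfPaths s t k len p e)
    (hd : IsMove len X Y d) (hcard : (h.guards X).card = (h.guards Y).card) {i : Fin k} {j : ℕ}
    (hj : j < len i) (hdj : (d i = 1 ∧ (j + X.parity i) % 2 = 0) ∨
      (d i = -1 ∧ (j + 1 + X.parity i) % 2 = 0)) :
    ∃ φ, G.IsDefense (e i j) (h.guards X) (h.guards Y) φ := by
  classical
  choose! φ hφ using fun x (hx : x ∈ h.guards X) => h.exists_goes hd hx
  have hmaps : Set.MapsTo φ (h.guards X) (h.guards Y) := fun x hx => (hφ x hx).mem_guards h hd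
  have hinj : Set.InjOn φ (h.guards X) := fun x hx y hy hxy =>
    (hφ x hx).left_unique h hd (hxy ▸ hφ y hy)
  refine ⟨φ, ⟨hmaps, hinj, Finset.surjOn_of_injOn_of_card_le φ hmaps hinj hcard.ge⟩,
    fun x hx => (hφ x hx).eq_or_adj h hd, ?_⟩
  have hmem : ∀ l, l ≤ len i → (l + X.parity i) % 2 = 0 → (l = 0 → d i = 1) →
      (l = len i → d i = -1) → p i l ∈ h.guards X := by
    intro l hl hpar h5 h6
    rcases Nat.eq_zero_or_pos l with rfl | h0
    · rw [h.first, h.source_mem_guards]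
      exact hd.source_of_leaves i ⟨h5 rfl, by omega⟩
    rcases hl.eq_or_lt with rfl | h1
    · rw [h.last, h.sink_mem_guards]
      exact hd.sink_of_leaves i ⟨h6 rfl, by omega⟩
    · exact (h.inner_mem_guards h0 h1).2 hpar
  rcases hdj with ⟨hi, hpar⟩ | ⟨hi, hpar⟩
  · have hx := hmem j hj.le hpar (fun _ => hi) (by omega)
    refine ⟨p i j, hx, ?_⟩
    rw [(hφ _ hx).right_unique h hd (Or.inr (Or.inr ⟨i, j, j + 1, hpar, hj.le, hj, by omega,
      fun _ => hi, by omega, rfl, rfl⟩))]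
    exact h.isLink i j hj
  · have hx := hmem (j + 1) hj hpar (by omega) (fun _ => hi)
    refine ⟨p i (j + 1), hx, ?_⟩
    rw [(hφ _ hx).right_unique h hd (Or.inr (Or.inr ⟨i, j + 1, j, hpar, hj, hj.le, by omega,
      by omega, fun _ => hi, rfl, rfl⟩))]
    exact (h.isLink i j hj).symm

open Classical in
/-- A class of placements that is closed under shifting any path either way gives an eternal
vertex cover class. -/
theorem mem_sizes_of_placements (h : G.IsParallelCompositionOfPaths s t k len p e)
    {K : Set (Placement k)} (hne : K.Nonempty) (hcov : ∀ X ∈ K, X.Covers len) {m : ℕ}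
    (hm : ∀ X ∈ K, m + X.deficit len =
      (if X.source then 1 else 0) + (if X.sink then 1 else 0) + ∑ i, len i / 2)
    (hfwd : ∀ X ∈ K, ∀ i, ∃ Y ∈ K, ∃ d, IsMove len X Y d ∧ d i = 1)
    (hbwd : ∀ X ∈ K, ∀ i, ∃ Y ∈ K, ∃ d, IsMove len X Y d ∧ d i = -1) :
    m ∈ G.eternalVertexCoverSizes := by
  have hcard : ∀ X ∈ K, (h.guards X).card = m := fun X hX => by
    have h1 := h.card_guards X
    have h2 := hm X hX
    omega
  refine ⟨h.guards '' K, ⟨hne.image _, ?_, ?_, ?_⟩, ?_⟩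
  · rintro _ ⟨X, hX, rfl⟩
    exact h.isVertexCover_guards (hcov X hX)
  · rintro _ ⟨X, hX, rfl⟩ _ ⟨Y, hY, rfl⟩
    rw [hcard X hX, hcard Y hY]
  · rintro _ ⟨X, hX, rfl⟩ f hf
    rw [h.edgeSet_eq] at hf
    obtain ⟨i, j, hj, rfl⟩ := hf
    -- Exactly one end of the edge has a position of the guarded parity; this decides which shift
    -- crosses the edge.
    by_cases hpar : (j + X.parity i) % 2 = 0
    · obtain ⟨Y, hY, d, hd, hi⟩ := hfwd X hX i
      exact ⟨_, ⟨Y, hY, rfl⟩, h.exists_isDefense hd ((hcard X hX).trans (hcard Y hY).symm) hj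
        (Or.inl ⟨hi, hpar⟩)⟩
    · obtain ⟨Y, hY, d, hd, hi⟩ := hbwd X hX i
      exact ⟨_, ⟨Y, hY, rfl⟩, h.exists_isDefense hd ((hcard X hX).trans (hcard Y hY).symm) hj
        (Or.inr ⟨hi, by omega⟩)⟩
  · rintro _ ⟨X, hX, rfl⟩
    exact hcard X hX

end IsParallelCompositionOfPaths
end Graph

namespace Graph

namespace Placement

variable {k : ℕ} {len : Fin k → ℕ}

/-- The placement after shifting the guards of the `i`-th path by `d i`. -/
def shift (X : Placement k) (d : Fin k → ℤ) (a b : Prop) : Placement k :=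
  ⟨a, b, fun i => X.parity i + (d i).natAbs⟩

/-! #### At least two paths of even length -/

/-- The placements with guards on the source and the sink and an additional guard on exactly one
path of even length. -/
def surplus (len : Fin k → ℕ) : Set (Placement k) :=
  {X | X.source ∧ X.sink ∧ ∃ i, len i % 2 = 0 ∧ X.parity i % 2 = 1 ∧
    ∀ j, j ≠ i → len j % 2 = 0 → X.parity j % 2 = 0}

/-- If `i` is the surplus path `i₀`, a guard enters the sink, whose own guard withdraws into another
even path `j`. If `i` is another even path, it takes the guard of the source, and `i₀` replaces it.
A path of odd length and odd parity shifts without touching the ends. With even parity it takes the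
guard of the source and sends one into the sink, so `i₀` refills the source and `j` relieves the
sink. -/
theorem exists_forward_of_mem_surplus (hne : ∀ i, ∃ j, j ≠ i ∧ len j % 2 = 0)
    {X : Placement k} (hX : X ∈ surplus len) (i : Fin k) :
    ∃ Y ∈ surplus len, ∃ d, IsMove len X Y d ∧ d i = 1 := by
  obtain ⟨hs, ht, i₀, h0, h1, hX⟩ := hX
  obtain ⟨j, hj, hj'⟩ := hne i₀
  by_cases hi : i = i₀
  · let d : Fin k → ℤ := fun l => if l = i₀ then 1 else if l = j then -1 else 0
    refine ⟨X.shift d True True, ⟨trivial, trivial, j, ?_⟩, d, ?_, ?_⟩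
    · simp only [shift, d]; grind
    · constructor <;>
      simp only [LeavesSource, EntersSource, LeavesSink, EntersSink, shift, d] <;> grind
    · simp only [d]; grind
  by_cases he : len i % 2 = 0
  · let d : Fin k → ℤ := fun l => if l = i then 1 else if l = i₀ then -1 else 0
    refine ⟨X.shift d True True, ⟨trivial, trivial, i, ?_⟩, d, ?_, ?_⟩
    · simp only [shift, d]; grind
    · constructor <;>
      simp only [LeavesSource, EntersSource, LeavesSink, EntersSink, shift, d] <;> grind
    · simp only [d]; grind
  by_cases hc : X.parity i % 2 = 1
  · let d : Fin k → ℤ := fun l => if l = i then 1 else 0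
    refine ⟨X.shift d True True, ⟨trivial, trivial, i₀, ?_⟩, d, ?_, ?_⟩
    · simp only [shift, d]; grind
    · constructor <;>
      simp only [LeavesSource, EntersSource, LeavesSink, EntersSink, shift, d] <;> grind
    · simp only [d]; grind
  · let d : Fin k → ℤ := fun l =>
      if l = i then 1 else if l = i₀ then -1 else if l = j then -1 else 0
    refine ⟨X.shift d True True, ⟨trivial, trivial, j, ?_⟩, d, ?_, ?_⟩
    · simp only [shift, d]; grind
    · constructor <;>
      simp only [LeavesSource, EntersSource, LeavesSink, EntersSink, shift, d] <;> grind
    · simp only [d]; grind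

/-- The same exchanges with source and sink interchanged. -/
theorem exists_backward_of_mem_surplus (hne : ∀ i, ∃ j, j ≠ i ∧ len j % 2 = 0)
    {X : Placement k} (hX : X ∈ surplus len) (i : Fin k) :
    ∃ Y ∈ surplus len, ∃ d, IsMove len X Y d ∧ d i = -1 := by
  obtain ⟨hs, ht, i₀, h0, h1, hX⟩ := hX
  obtain ⟨j, hj, hj'⟩ := hne i₀
  by_cases hi : i = i₀
  · let d : Fin k → ℤ := fun l => if l = i₀ then -1 else if l = j then 1 else 0
    refine ⟨X.shift d True True, ⟨trivial, trivial, j, ?_⟩, d, ?_, ?_⟩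
    · simp only [shift, d]; grind
    · constructor <;>
      simp only [LeavesSource, EntersSource, LeavesSink, EntersSink, shift, d] <;> grind
    · simp only [d]; grind
  by_cases he : len i % 2 = 0
  · let d : Fin k → ℤ := fun l => if l = i then -1 else if l = i₀ then 1 else 0
    refine ⟨X.shift d True True, ⟨trivial, trivial, i, ?_⟩, d, ?_, ?_⟩
    · simp only [shift, d]; grind
    · constructor <;>
      simp only [LeavesSource, EntersSource, LeavesSink, EntersSink, shift, d] <;> grind
    · simp only [d]; grind
  by_cases hc : X.parity i % 2 = 0
  · let d : Fin k → ℤ := fun l => if l = i then -1 else 0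
    refine ⟨X.shift d True True, ⟨trivial, trivial, i₀, ?_⟩, d, ?_, ?_⟩
    · simp only [shift, d]; grind
    · constructor <;>
      simp only [LeavesSource, EntersSource, LeavesSink, EntersSink, shift, d] <;> grind
    · simp only [d]; grind
  · let d : Fin k → ℤ := fun l => if l = i then -1 else if l = i₀ then 1 else if l = j then 1 else 0
    refine ⟨X.shift d True True, ⟨trivial, trivial, j, ?_⟩, d, ?_, ?_⟩
    · simp only [shift, d]; grind
    · constructor <;>
      simp only [LeavesSource, EntersSource, LeavesSink, EntersSink, shift, d] <;> grind
    · simp only [d]; grind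

/-! #### Only paths of odd length -/

/-- The two placements that guard every other vertex of each path, when all lengths are odd. -/
def alternating (k : ℕ) : Set (Placement k) :=
  {X | (X.source ∧ ¬X.sink ∧ ∀ i, X.parity i % 2 = 0) ∨
    (¬X.source ∧ X.sink ∧ ∀ i, X.parity i % 2 = 1)}

/-- Each move interchanges the two kinds of placement. With the source guarded, `i` passes a guard
from source to sink. With the sink guarded, the shift of `i` leaves the ends alone, and a second
path `j` must bring the guard back. -/
theorem exists_forward_of_mem_alternating (hlen : ∀ i, len i % 2 = 1)
    (hne : ∀ i : Fin k, ∃ j, j ≠ i) {X : Placement k} (hX : X ∈ alternating k) (i : Fin k) :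
    ∃ Y ∈ alternating k, ∃ d, IsMove len X Y d ∧ d i = 1 := by
  obtain ⟨j, hj⟩ := hne i
  have hli := hlen i
  have hlj := hlen j
  rcases hX with ⟨hs, ht, hX⟩ | ⟨hs, ht, hX⟩ <;> have hXi := hX i <;> have hXj := hX j
  · let d : Fin k → ℤ := fun l => if l = i then 1 else -1
    refine ⟨X.shift d False True, Or.inr ?_, d, ?_, ?_⟩
    · simp only [shift, d]; grind
    · constructor <;>
      simp only [LeavesSource, EntersSource, LeavesSink, EntersSink, shift, d] <;> grind
    · simp only [d]; grind
  · let d : Fin k → ℤ := fun l => if l = j then -1 else 1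
    refine ⟨X.shift d True False, Or.inl ?_, d, ?_, ?_⟩
    · simp only [shift, d]; grind
    · constructor <;>
      simp only [LeavesSource, EntersSource, LeavesSink, EntersSink, shift, d] <;> grind
    · simp only [d]; grind

theorem exists_backward_of_mem_alternating (hlen : ∀ i, len i % 2 = 1)
    (hne : ∀ i : Fin k, ∃ j, j ≠ i) {X : Placement k} (hX : X ∈ alternating k) (i : Fin k) :
    ∃ Y ∈ alternating k, ∃ d, IsMove len X Y d ∧ d i = -1 := by
  obtain ⟨j, hj⟩ := hne i
  have hli := hlen i
  have hlj := hlen j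
  rcases hX with ⟨hs, ht, hX⟩ | ⟨hs, ht, hX⟩ <;> have hXi := hX i <;> have hXj := hX j
  · let d : Fin k → ℤ := fun l => if l = j then 1 else -1
    refine ⟨X.shift d False True, Or.inr ?_, d, ?_, ?_⟩
    · simp only [shift, d]; grind
    · constructor <;>
      simp only [LeavesSource, EntersSource, LeavesSink, EntersSink, shift, d] <;> grind
    · simp only [d]; grind
  · let d : Fin k → ℤ := fun l => if l = i then -1 else 1
    refine ⟨X.shift d True False, Or.inl ?_, d, ?_, ?_⟩
    · simp only [shift, d]; grind
    · constructor <;>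
      simp only [LeavesSource, EntersSource, LeavesSink, EntersSink, shift, d] <;> grind
    · simp only [d]; grind

/-! #### One path of even length -/

/-- The placements used when only the length of the path `i₀` is even. -/
def oneEven (i₀ : Fin k) : Set (Placement k) :=
  {X | (X.source ∧ X.sink ∧ X.parity i₀ % 2 = 0) ∨
    (X.source ∧ ¬X.sink ∧ X.parity i₀ % 2 = 1 ∧ ∀ i, i ≠ i₀ → X.parity i % 2 = 0) ∨
    (¬X.source ∧ X.sink ∧ X.parity i₀ % 2 = 1 ∧ ∀ i, i ≠ i₀ → X.parity i % 2 = 1)}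

/-- While both ends are guarded the odd paths may have any parity, and one that can shift without
touching the ends does so alone. Otherwise the source is vacated, and all odd paths adopt the parity
that covers the edges there. From a placement with one free end, either both ends become guarded as
`i₀` gives up its additional guard, or the guard passes from source to sink along `i`. -/
theorem exists_forward_of_mem_oneEven {i₀ : Fin k} (h0 : len i₀ % 2 = 0)
    (hlen : ∀ i, i ≠ i₀ → len i % 2 = 1) (hne : ∃ j, j ≠ i₀) {X : Placement k}
    (hX : X ∈ oneEven i₀) (i : Fin k) :
    ∃ Y ∈ oneEven i₀, ∃ d, IsMove len X Y d ∧ d i = 1 := by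
  obtain ⟨j, hj⟩ := hne
  have hli := hlen i
  have hlj := hlen j
  rcases hX with ⟨hs, ht, hX⟩ | ⟨hs, ht, hX, hX'⟩ | ⟨hs, ht, hX, hX'⟩
  · by_cases hi : i = i₀
    · let d : Fin k → ℤ := fun l => if l = i₀ then 1 else if X.parity l % 2 = 0 then -1 else 0
      refine ⟨X.shift d False True, Or.inr (Or.inr ?_), d, ?_, ?_⟩
      · simp only [shift, d]; grind
      · constructor <;>
        simp only [LeavesSource, EntersSource, LeavesSink, EntersSink, shift, d] <;> grind
      · simp only [d]; grind
    by_cases hc : X.parity i % 2 = 0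
    · let d : Fin k → ℤ := fun l => if l = i then 1 else if l = i₀ then -1 else
              if X.parity l % 2 = 0 then -1 else 0
      refine ⟨X.shift d False True, Or.inr (Or.inr ?_), d, ?_, ?_⟩
      · simp only [shift, d]; grind
      · constructor <;>
        simp only [LeavesSource, EntersSource, LeavesSink, EntersSink, shift, d] <;> grind
      · simp only [d]; grind
    · let d : Fin k → ℤ := fun l => if l = i then 1 else 0
      refine ⟨X.shift d True True, Or.inl ?_, d, ?_, ?_⟩
      · simp only [shift, d]; grind
      · constructor <;>
        simp only [LeavesSource, EntersSource, LeavesSink, EntersSink, shift, d] <;> grind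
      · simp only [d]; grind
  · have hXi := hX' i
    have hXj := hX' j
    by_cases hi : i = i₀
    · let d : Fin k → ℤ := fun l => if l = i₀ then 1 else 0
      refine ⟨X.shift d True True, Or.inl ?_, d, ?_, ?_⟩
      · simp only [shift, d]; grind
      · constructor <;>
        simp only [LeavesSource, EntersSource, LeavesSink, EntersSink, shift, d] <;> grind
      · simp only [d]; grind
    · let d : Fin k → ℤ := fun l => if l = i then 1 else if l = i₀ then 0 else -1
      refine ⟨X.shift d False True, Or.inr (Or.inr ?_), d, ?_, ?_⟩
      · simp only [shift, d]; grind
      · constructor <;>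
        simp only [LeavesSource, EntersSource, LeavesSink, EntersSink, shift, d] <;> grind
      · simp only [d]; grind
  · have hXi := hX' i
    have hXj := hX' j
    by_cases hi : i = i₀
    · let d : Fin k → ℤ := fun l => if l = i₀ then 1 else if l = j then -1 else 0
      refine ⟨X.shift d True True, Or.inl ?_, d, ?_, ?_⟩
      · simp only [shift, d]; grind
      · constructor <;>
        simp only [LeavesSource, EntersSource, LeavesSink, EntersSink, shift, d] <;> grind
      · simp only [d]; grind
    · let d : Fin k → ℤ := fun l => if l = i then 1 else if l = i₀ then -1 else 0
      refine ⟨X.shift d True True, Or.inl ?_, d, ?_, ?_⟩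
      · simp only [shift, d]; grind
      · constructor <;>
        simp only [LeavesSource, EntersSource, LeavesSink, EntersSink, shift, d] <;> grind
      · simp only [d]; grind

/-- The same moves with source and sink interchanged. -/
theorem exists_backward_of_mem_oneEven {i₀ : Fin k} (h0 : len i₀ % 2 = 0)
    (hlen : ∀ i, i ≠ i₀ → len i % 2 = 1) (hne : ∃ j, j ≠ i₀) {X : Placement k}
    (hX : X ∈ oneEven i₀) (i : Fin k) :
    ∃ Y ∈ oneEven i₀, ∃ d, IsMove len X Y d ∧ d i = -1 := by
  obtain ⟨j, hj⟩ := hne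
  have hli := hlen i
  have hlj := hlen j
  rcases hX with ⟨hs, ht, hX⟩ | ⟨hs, ht, hX, hX'⟩ | ⟨hs, ht, hX, hX'⟩
  · by_cases hi : i = i₀
    · let d : Fin k → ℤ := fun l => if l = i₀ then -1 else if X.parity l % 2 = 1 then 1 else 0
      refine ⟨X.shift d True False, Or.inr (Or.inl ?_), d, ?_, ?_⟩
      · simp only [shift, d]; grind
      · constructor <;>
        simp only [LeavesSource, EntersSource, LeavesSink, EntersSink, shift, d] <;> grind
      · simp only [d]; grind
    by_cases hc : X.parity i % 2 = 1
    · let d : Fin k → ℤ := fun l => if l = i then -1 else if l = i₀ then 1 else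
              if X.parity l % 2 = 1 then 1 else 0
      refine ⟨X.shift d True False, Or.inr (Or.inl ?_), d, ?_, ?_⟩
      · simp only [shift, d]; grind
      · constructor <;>
        simp only [LeavesSource, EntersSource, LeavesSink, EntersSink, shift, d] <;> grind
      · simp only [d]; grind
    · let d : Fin k → ℤ := fun l => if l = i then -1 else 0
      refine ⟨X.shift d True True, Or.inl ?_, d, ?_, ?_⟩
      · simp only [shift, d]; grind
      · constructor <;>
        simp only [LeavesSource, EntersSource, LeavesSink, EntersSink, shift, d] <;> grind
      · simp only [d]; grind
  · have hXi := hX' i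
    have hXj := hX' j
    by_cases hi : i = i₀
    · let d : Fin k → ℤ := fun l => if l = i₀ then -1 else if l = j then 1 else 0
      refine ⟨X.shift d True True, Or.inl ?_, d, ?_, ?_⟩
      · simp only [shift, d]; grind
      · constructor <;>
        simp only [LeavesSource, EntersSource, LeavesSink, EntersSink, shift, d] <;> grind
      · simp only [d]; grind
    · let d : Fin k → ℤ := fun l => if l = i then -1 else if l = i₀ then 1 else 0
      refine ⟨X.shift d True True, Or.inl ?_, d, ?_, ?_⟩
      · simp only [shift, d]; grind
      · constructor <;>
        simp only [LeavesSource, EntersSource, LeavesSink, EntersSink, shift, d] <;> grind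
      · simp only [d]; grind
  · have hXi := hX' i
    have hXj := hX' j
    by_cases hi : i = i₀
    · let d : Fin k → ℤ := fun l => if l = i₀ then -1 else 0
      refine ⟨X.shift d True True, Or.inl ?_, d, ?_, ?_⟩
      · simp only [shift, d]; grind
      · constructor <;>
        simp only [LeavesSource, EntersSource, LeavesSink, EntersSink, shift, d] <;> grind
      · simp only [d]; grind
    · let d : Fin k → ℤ := fun l => if l = i then -1 else if l = i₀ then 0 else 1
      refine ⟨X.shift d True False, Or.inr (Or.inl ?_), d, ?_, ?_⟩
      · simp only [shift, d]; grind
      · constructor <;>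
        simp only [LeavesSource, EntersSource, LeavesSink, EntersSink, shift, d] <;> grind
      · simp only [d]; grind

/-! #### Even cycles -/

/-- The two placements that guard every other vertex of each path, when all lengths are even. -/
def evenAlternating (k : ℕ) : Set (Placement k) :=
  {X | (X.source ∧ X.sink ∧ ∀ i, X.parity i % 2 = 0) ∨
    (¬X.source ∧ ¬X.sink ∧ ∀ i, X.parity i % 2 = 1)}

/-- All guards rotate around the cycle: one path shifts forward and the other backward, which
vacates or fills both ends at once. -/
theorem exists_forward_of_mem_evenAlternating {len : Fin 2 → ℕ} (hlen : ∀ i, len i % 2 = 0)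
    {X : Placement 2} (hX : X ∈ evenAlternating 2) (i : Fin 2) :
    ∃ Y ∈ evenAlternating 2, ∃ d, IsMove len X Y d ∧ d i = 1 := by
  obtain ⟨j, hj⟩ := exists_ne i
  have two : ∀ l, l = i ∨ l = j := by omega
  have hli := hlen i
  have hlj := hlen j
  rcases hX with ⟨hs, ht, hX⟩ | ⟨hs, ht, hX⟩ <;> have hXi := hX i <;> have hXj := hX j
  · let d : Fin 2 → ℤ := fun l => if l = i then 1 else -1
    refine ⟨X.shift d False False, Or.inr ?_, d, ?_, ?_⟩
    · simp only [shift, d]; grind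
    · constructor <;>
      simp only [LeavesSource, EntersSource, LeavesSink, EntersSink, shift, d] <;> grind
    · simp only [d]; grind
  · let d : Fin 2 → ℤ := fun l => if l = i then 1 else -1
    refine ⟨X.shift d True True, Or.inl ?_, d, ?_, ?_⟩
    · simp only [shift, d]; grind
    · constructor <;>
      simp only [LeavesSource, EntersSource, LeavesSink, EntersSink, shift, d] <;> grind
    · simp only [d]; grind

theorem exists_backward_of_mem_evenAlternating {len : Fin 2 → ℕ} (hlen : ∀ i, len i % 2 = 0)
    {X : Placement 2} (hX : X ∈ evenAlternating 2) (i : Fin 2) :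
    ∃ Y ∈ evenAlternating 2, ∃ d, IsMove len X Y d ∧ d i = -1 := by
  obtain ⟨j, hj⟩ := exists_ne i
  have two : ∀ l, l = i ∨ l = j := by omega
  have hli := hlen i
  have hlj := hlen j
  rcases hX with ⟨hs, ht, hX⟩ | ⟨hs, ht, hX⟩ <;> have hXi := hX i <;> have hXj := hX j
  · let d : Fin 2 → ℤ := fun l => if l = i then -1 else 1
    refine ⟨X.shift d False False, Or.inr ?_, d, ?_, ?_⟩
    · simp only [shift, d]; grind
    · constructor <;>
      simp only [LeavesSource, EntersSource, LeavesSink, EntersSink, shift, d] <;> grind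
    · simp only [d]; grind
  · let d : Fin 2 → ℤ := fun l => if l = i then -1 else 1
    refine ⟨X.shift d True True, Or.inl ?_, d, ?_, ?_⟩
    · simp only [shift, d]; grind
    · constructor <;>
      simp only [LeavesSource, EntersSource, LeavesSink, EntersSink, shift, d] <;> grind
    · simp only [d]; grind

end Placement
end Graph

namespace Graph

/-! ### The eternal vertex cover number of melon graphs -/

namespace IsParallelCompositionOfPaths

open Placement

variable {α β : Type*} {G : Graph α β} {s t : α} {k : ℕ} {len : Fin k → ℕ} {p : Fin k → ℕ → α}
  {e : Fin k → ℕ → β}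

theorem evenCount_eq_card (len : Fin k → ℕ) :
    evenCount len = (Finset.univ.filter fun i => len i % 2 = 0).card :=
  (Finset.card_filter _ _).symm

theorem evenCount_le_sum_half (hl : ∀ i, 1 ≤ len i) : evenCount len ≤ ∑ i, len i / 2 := by
  refine Finset.sum_le_sum fun i _ => ?_
  have := hl i
  split_ifs <;> omega

theorem deficit_surplus {X : Placement k} (hX : X ∈ surplus len) :
    X.deficit len + 1 = evenCount len := by
  classical
  obtain ⟨-, -, i₀, h0, h1, hX⟩ := hX
  have : evenCount len = ∑ i, ((if len i % 2 = 0 ∧ X.parity i % 2 = 0 then 1 else 0) +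
      if i = i₀ then 1 else 0) := by
    refine Finset.sum_congr rfl fun i _ => ?_
    grind
  rw [this, Finset.sum_add_distrib, deficit]
  simp

/-- Both ends are guarded, and every even path except the surplus one lacks a guard. A second even
path is what lets the surplus move. -/
theorem mem_sizes_of_two_even (h : G.IsParallelCompositionOfPaths s t k len p e)
    (hk : 2 ≤ evenCount len) {m : ℕ} (hm : m + evenCount len = ∑ i, len i / 2 + 3) :
    m ∈ G.eternalVertexCoverSizes := by
  classical
  have hne : ∀ i, ∃ j, j ≠ i ∧ len j % 2 = 0 := by
    intro i
    rw [evenCount_eq_card] at hk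
    obtain ⟨j, hj, hji⟩ := Finset.exists_mem_ne hk i
    exact ⟨j, hji, (Finset.mem_filter.1 hj).2⟩
  obtain ⟨i₀, h0⟩ := exists_even (len := len) (by omega)
  refine h.mem_sizes_of_placements (K := surplus len)
    ⟨⟨True, True, fun i => if i = i₀ then 1 else 0⟩, trivial, trivial, i₀, h0, by simp,
      fun j hj _ => by simp [hj]⟩ ?_ ?_ (fun X => exists_forward_of_mem_surplus hne)
    (fun X => exists_backward_of_mem_surplus hne)
  · exact fun X hX => ⟨fun hs => absurd hX.1 hs, fun ht => absurd hX.2.1 ht,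
      fun hs => absurd hX.1 hs⟩
  · intro X hX
    have := deficit_surplus hX
    rw [if_pos hX.1, if_pos hX.2.1]
    omega

theorem mem_sizes_of_no_even (h : G.IsParallelCompositionOfPaths s t k len p e) (hk : 2 ≤ k)
    (h0 : evenCount len = 0) : ∑ i, len i / 2 + 1 ∈ G.eternalVertexCoverSizes := by
  classical
  have hlen : ∀ i, len i % 2 = 1 := by
    intro i
    have := (Finset.sum_eq_zero_iff.1 h0) i (Finset.mem_univ i)
    split_ifs at this
    omega
  have hne : ∀ i : Fin k, ∃ j, j ≠ i := fun i => by
    have : Nontrivial (Fin k) := Fin.nontrivial_iff_two_le.2 hk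
    exact exists_ne i
  refine h.mem_sizes_of_placements (K := alternating k)
    ⟨⟨True, False, fun i => 0⟩, Or.inl ⟨trivial, id, fun _ => rfl⟩⟩ ?_ ?_
    (fun X => exists_forward_of_mem_alternating hlen hne)
    (fun X => exists_backward_of_mem_alternating hlen hne)
  · rintro X (⟨hs, ht, hX⟩ | ⟨hs, ht, hX⟩)
    · exact ⟨fun h => absurd hs h, fun _ i => by have := hX i; have := hlen i; omega,
        fun h => absurd hs h⟩
    · exact ⟨fun _ => hX, fun h => absurd ht h, fun _ h => absurd ht h⟩
  · intro X hX
    have : X.deficit len = 0 := Finset.sum_eq_zero fun i _ => if_neg fun hi => by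
      have := hlen i
      omega
    rw [this]
    rcases hX with ⟨hs, ht, -⟩ | ⟨hs, ht, -⟩ <;> simp only [hs, ht, if_true, if_false] <;> omega

/-- The size is constant: two guarded ends with deficit 1, or one guarded end with deficit 0. -/
theorem mem_sizes_of_one_even (h : G.IsParallelCompositionOfPaths s t k len p e) (hk : 2 ≤ k)
    (h1 : evenCount len = 1) : ∑ i, len i / 2 + 1 ∈ G.eternalVertexCoverSizes := by
  classical
  rw [evenCount_eq_card, Finset.card_eq_one] at h1
  obtain ⟨i₀, hi₀⟩ := h1
  simp only [Finset.ext_iff, Finset.mem_filter, Finset.mem_univ, true_and,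
    Finset.mem_singleton] at hi₀
  have h0 : len i₀ % 2 = 0 := (hi₀ i₀).2 rfl
  have hlen : ∀ i, i ≠ i₀ → len i % 2 = 1 := fun i hi => by
    have := mt (hi₀ i).1 hi
    omega
  have hne : ∃ j, j ≠ i₀ := by
    have : Nontrivial (Fin k) := Fin.nontrivial_iff_two_le.2 hk
    exact exists_ne i₀
  have hdef : ∀ X : Placement k, X.deficit len = if X.parity i₀ % 2 = 0 then 1 else 0 := by
    intro X
    rw [deficit, Finset.sum_eq_single i₀ (fun i _ hi => if_neg fun h => hi ((hi₀ i).1 h.1))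
      (fun hi => absurd (Finset.mem_univ _) hi)]
    simp [h0]
  refine h.mem_sizes_of_placements (K := oneEven i₀)
    ⟨⟨True, True, fun i => 0⟩, Or.inl ⟨trivial, trivial, rfl⟩⟩ ?_ ?_
    (fun X => exists_forward_of_mem_oneEven h0 hlen hne)
    (fun X => exists_backward_of_mem_oneEven h0 hlen hne)
  · rintro X (⟨hs, ht, hX⟩ | ⟨hs, ht, hX, hX'⟩ | ⟨hs, ht, hX, hX'⟩)
    · exact ⟨fun h => absurd hs h, fun h => absurd ht h, fun h => absurd hs h⟩
    · exact ⟨fun h => absurd hs h, fun _ i => by grind, fun h => absurd hs h⟩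
    · exact ⟨fun _ i => by grind, fun h => absurd ht h, fun _ h => absurd ht h⟩
  · rintro X (⟨hs, ht, hX⟩ | ⟨hs, ht, hX, -⟩ | ⟨hs, ht, hX, -⟩) <;> rw [hdef, hX] <;>
      simp only [hs, ht, if_true, if_false, one_ne_zero] <;> omega

/-- The size is constant: two guarded ends with deficit 2, or none with deficit 0. -/
theorem mem_sizes_of_even_cycle {len : Fin 2 → ℕ} {p : Fin 2 → ℕ → α} {e : Fin 2 → ℕ → β}
    (h : G.IsParallelCompositionOfPaths s t 2 len p e) (h2 : evenCount len = 2) :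
    ∑ i, len i / 2 ∈ G.eternalVertexCoverSizes := by
  classical
  have hlen : ∀ i, len i % 2 = 0 := by
    have : (Finset.univ.filter fun i => len i % 2 = 0) = Finset.univ := by
      rw [← Finset.card_eq_iff_eq_univ, ← evenCount_eq_card, h2]
      rfl
    intro i
    have hi := Finset.mem_univ i
    rw [← this] at hi
    exact (Finset.mem_filter.1 hi).2
  refine h.mem_sizes_of_placements (K := evenAlternating 2)
    ⟨⟨True, True, fun i => 0⟩, Or.inl ⟨trivial, trivial, fun _ => rfl⟩⟩ ?_ ?_
    (fun X => exists_forward_of_mem_evenAlternating hlen)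
    (fun X => exists_backward_of_mem_evenAlternating hlen)
  · rintro X (⟨hs, ht, hX⟩ | ⟨hs, ht, hX⟩)
    · exact ⟨fun h => absurd hs h, fun h => absurd ht h, fun h => absurd hs h⟩
    · exact ⟨fun _ => hX, fun _ i => by have := hX i; have := hlen i; omega,
        fun _ _ i => by have := hlen i; omega⟩
  · rintro X (⟨hs, ht, hX⟩ | ⟨hs, ht, hX⟩)
    · have : X.deficit len = 2 := by simp [deficit, hX, hlen]
      rw [this]
      simp only [hs, ht, if_true]
      omega
    · have : X.deficit len = 0 := by simp [deficit, hX]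
      rw [this]
      simp only [hs, ht, if_false]
      omega

/-- A guard on every vertex but one suffices. -/
theorem pred_ncard_mem_sizes (h : G.IsParallelCompositionOfPaths s t k len p e) :
    G.vertexSet.ncard - 1 ∈ G.eternalVertexCoverSizes := by
  classical
  have hmem : ∀ x, x ∈ h.finite_vertexSet.toFinset ↔ x ∈ G.vertexSet := by simp
  have hcard : ∀ v ∈ G.vertexSet, (h.finite_vertexSet.toFinset.erase v).card =
      G.vertexSet.ncard - 1 := by
    intro v hv
    rw [Finset.card_erase_of_mem ((hmem v).2 hv), Set.ncard_eq_toFinset_card _ h.finite_vertexSet]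
  have hne : ∀ f x y, G.IsLink f x y → x ≠ y := by
    intro f x y hf
    obtain ⟨i, j, hj, rfl, ⟨rfl, rfl⟩ | ⟨rfl, rfl⟩⟩ := h.isLink_iff.1 hf
    · exact h.apply_ne_apply_succ hj
    · exact (h.apply_ne_apply_succ hj).symm
  refine ⟨{U | ∃ v ∈ G.vertexSet, U = h.finite_vertexSet.toFinset.erase v}, ⟨?_, ?_, ?_, ?_⟩, ?_⟩
  · exact ⟨_, s, h.mem_vertexSet_iff.2 (Or.inl rfl), rfl⟩
  · rintro _ ⟨v, hv, rfl⟩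
    refine ⟨fun x hx => (hmem x).1 (Finset.mem_of_mem_erase hx), fun f x y hf => ?_⟩
    simp only [Finset.mem_erase, hmem, hf.left_mem, hf.right_mem, and_true]
    by_contra! hcon
    exact hne f x y hf (hcon.1.trans hcon.2.symm)
  · rintro _ ⟨v, hv, rfl⟩ _ ⟨w, hw, rfl⟩
    rw [hcard v hv, hcard w hw]
  · rintro _ ⟨v, hv, rfl⟩ f hf
    obtain ⟨x, y, hxy⟩ := G.exists_isLink_of_mem_edgeSet hf
    have hx := hxy.left_mem
    have hy := hxy.right_mem
    have hswap : ∀ z, Equiv.swap x y z ∈ G.vertexSet ↔ z ∈ G.vertexSet := fun z => by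
      rw [Equiv.swap_apply_def]
      split_ifs with h1 h2 <;> simp_all
    -- The ends of the attacked edge are exchanged. If one of them is the free vertex, the other
    -- guard crosses and the free place moves along with it.
    refine ⟨_, ⟨Equiv.swap x y v, (hswap v).2 hv, rfl⟩, Equiv.swap x y,
      ⟨?_, (Equiv.injective _).injOn, ?_⟩, ?_, ?_⟩
    · intro z hz
      simp only [Finset.mem_coe, Finset.mem_erase, hmem] at hz ⊢
      exact ⟨fun hzv => hz.1 ((Equiv.injective _) hzv), (hswap z).2 hz.2⟩
    · intro z hz
      simp only [Finset.mem_coe, Finset.mem_erase, hmem] at hz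
      refine ⟨Equiv.swap x y z, ?_, Equiv.swap_apply_self x y z⟩
      simp only [Finset.mem_coe, Finset.mem_erase, hmem]
      exact ⟨fun hzv => hz.1 (by rw [← hzv, Equiv.swap_apply_self]), (hswap z).2 hz.2⟩
    · intro z _
      rw [Equiv.swap_apply_def]
      split_ifs with h1 h2
      · exact Or.inr ⟨f, h1 ▸ hxy⟩
      · exact Or.inr ⟨f, h2 ▸ hxy.symm⟩
      · exact Or.inl rfl
    · by_cases hxv : x = v
      · refine ⟨y, ?_, ?_⟩
        · simp only [Finset.mem_erase, hmem]
          exact ⟨fun hyv => hne f x y hxy (hxv.trans hyv.symm), hy⟩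
        · rw [Equiv.swap_apply_right]
          exact hxy.symm
      · refine ⟨x, ?_, ?_⟩
        · simp only [Finset.mem_erase, hmem]
          exact ⟨hxv, hx⟩
        · rwa [Equiv.swap_apply_left]
  · rintro _ ⟨v, hv, rfl⟩
    exact hcard v hv

end IsParallelCompositionOfPaths

/-- The eternal vertex cover number of a melon graph with `n` vertices and `k` paths, `q` of which
have even length. -/
def melonNumber (n k q : ℕ) : ℕ :=
  if k = 1 then n - 1 else if k = 2 then (n + 1) / 2 else
    if q ≤ 2 then (n + q) / 2 else (n - q) / 2 + 2

namespace IsParallelCompositionOfPaths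

variable {α β : Type*} {G : Graph α β} {s t : α} {k : ℕ} {len : Fin k → ℕ} {p : Fin k → ℕ → α}
  {e : Fin k → ℕ → β}

/-- The bounds meet in every case; `two_mul_sum_half` rewrites them in terms of the number of
vertices. -/
theorem evc_eq (h : G.IsParallelCompositionOfPaths s t k len p e) :
    G.evc = melonNumber G.vertexSet.ncard k (evenCount len) := by
  have hev := (G.isLeast_evc h.finite_vertexSet).1
  have hle : ∀ m ∈ G.eternalVertexCoverSizes, G.evc ≤ m := fun m hm => Nat.sInf_le hm
  have hn := h.two_mul_sum_half
  have hq := evenCount_le_sum_half h.one_le_len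
  have hqk := evenCount_le len
  have hk := h.one_le_k
  unfold melonNumber
  split_ifs with h1 h2 h3
  · subst h1
    refine le_antisymm (hle _ h.pred_ncard_mem_sizes) ?_
    have h4 := h.le_of_eq_one hev
    have h5 := h.ncard_vertexSet
    have h6 := h.one_le_len 0
    rw [Fin.sum_univ_one] at h5
    omega
  · subst h2
    have h4 := h.le_of_two_le le_rfl hqk hev
    by_cases h5 : evenCount len = 2
    · have := hle _ (h.mem_sizes_of_even_cycle h5)
      omega
    by_cases h6 : evenCount len = 1
    · have := hle _ (h.mem_sizes_of_one_even le_rfl h6)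
      omega
    · have := hle _ (h.mem_sizes_of_no_even le_rfl (by omega))
      omega
  · have h4 := h.le_of_three_le (by omega) hev
    by_cases h5 : evenCount len = 2
    · have := hle (∑ i, len i / 2 + 1) (h.mem_sizes_of_two_even h5.ge (by omega))
      omega
    by_cases h6 : evenCount len = 1
    · have := hle _ (h.mem_sizes_of_one_even (by omega) h6)
      omega
    · have := hle _ (h.mem_sizes_of_no_even (by omega) (by omega))
      omega
  · have h4 := h.le_of_three_le (by omega) hev
    have := hle (∑ i, len i / 2 + 3 - evenCount len) (h.mem_sizes_of_two_even (by omega) (by omega))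
    omega

end IsParallelCompositionOfPaths
end Graph

namespace Graph

/-! ### Adjacency lists of melon graphs -/

section

variable {α β : Type*} {G : Graph α β} {A : List (List ℕ)}

/-- `ν` numbers the vertices of `G` in the way `A` represents `G`. -/
structure IsNumbering (G : Graph α β) (A : List (List ℕ)) (ν : α → ℕ) : Prop where
  bijOn : Set.BijOn ν G.vertexSet (Set.Iio A.length)
  entry_lt : ∀ (a : ℕ) (ha : a < A.length), ∀ b ∈ A[a], b < A.length
  count : ∀ x ∈ G.vertexSet, ∀ y ∈ G.vertexSet,
    (((A.getD (ν x) []).count (ν y) : ℕ) : ℕ∞) = {e | G.IsLink e x y}.encard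

theorem IsAdjacencyList.exists_isNumbering (hA : G.IsAdjacencyList A) :
    ∃ ν, G.IsNumbering A ν := by
  obtain ⟨σ, hσ, hA⟩ := hA
  have hinv := hσ.invOn_invFunOn
  have hbij := hσ.symm hinv.symm
  refine ⟨_, hbij, fun a ha => (hA a ha).1, fun x hx y hy => ?_⟩
  have hxn := hbij.mapsTo hx
  have := (hA _ hxn).2 _ (hbij.mapsTo hy)
  rw [hinv.2 hx, hinv.2 hy] at this
  rw [← this, List.getD_eq_getElem _ _ hxn]

namespace IsNumbering

variable {ν : α → ℕ}

theorem apply_lt (hν : G.IsNumbering A ν) {x : α} (hx : x ∈ G.vertexSet) : ν x < A.length :=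
  hν.bijOn.mapsTo hx

theorem ncard_eq (hν : G.IsNumbering A ν) : G.vertexSet.ncard = A.length := by
  rw [← hν.bijOn.injOn.ncard_image, hν.bijOn.image_eq, Set.ncard_Iio_nat]

/-- If `E` enumerates the edges at `x` and `N` the corresponding neighbours, then `N` enumerates
the adjacency list of `x`. -/
theorem coe_eq_map (hν : G.IsNumbering A ν) {ι : Type*} [Fintype ι] {x : α}
    (hx : x ∈ G.vertexSet) {E : ι → β} {N : ι → α} (hE : Function.Injective E)
    (hEN : ∀ f y, G.IsLink f x y ↔ ∃ c, f = E c ∧ y = N c) :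
    ((A.getD (ν x) [] : List ℕ) : Multiset ℕ) = Finset.univ.val.map fun c => ν (N c) := by
  classical
  have hN : ∀ c, N c ∈ G.vertexSet := fun c => ((hEN (E c) (N c)).2 ⟨c, rfl, rfl⟩).right_mem
  -- Multiplicities are compared: `ν y` occurs once for each edge from `x` to `y`, hence once for
  -- each `c` with `N c = y`. Numbers that belong to no vertex occur on neither side.
  ext b
  rw [Multiset.coe_count, Multiset.count_map]
  by_cases hb : b < A.length
  · obtain ⟨y, hy, rfl⟩ := hν.bijOn.surjOn hb
    have h1 := hν.count x hx y hy
    have h2 : {f | G.IsLink f x y} = E '' {c | y = N c} := by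
      ext f
      simp only [Set.mem_ofPred_eq, hEN, Set.mem_image]
      exact ⟨fun ⟨c, h, h'⟩ => ⟨c, h', h.symm⟩, fun ⟨c, h', h⟩ => ⟨c, h.symm, h'⟩⟩
    rw [h2, hE.encard_image] at h1
    have h3 : {c | y = N c} = ((Finset.univ.filter fun c => ν y = ν (N c) : Finset ι) : Set ι) := by
      ext c
      simp only [Set.mem_ofPred_eq, Finset.coe_filter, Finset.mem_univ, true_and]
      exact ⟨fun h => h ▸ rfl, fun h => hν.bijOn.injOn hy (hN c) h⟩
    rw [h3, Set.encard_coe_eq_coe_finsetCard] at h1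
    exact_mod_cast h1
  · rw [List.count_eq_zero_of_not_mem, Multiset.filter_eq_nil.2, Multiset.card_zero]
    · rintro c - rfl
      exact hb (hν.apply_lt (hN c))
    · intro hmem
      have hxn := hν.apply_lt hx
      rw [List.getD_eq_getElem _ _ hxn] at hmem
      exact hb (hν.entry_lt _ hxn b hmem)

end IsNumbering

end

/-- Pulls a permutation of values back to the indices; it provides the order in which the list of
the source names the paths. -/
theorem exists_map_eq_of_coe_eq_map {ι κ : Type*} {f : ι → κ} {L : List κ} {l : List ι}
    (h : (L : Multiset κ) = (l : Multiset ι).map f) :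
    ∃ l' : List ι, l'.Perm l ∧ L = l'.map f := by
  rw [Multiset.map_coe, Multiset.coe_eq_coe] at h
  have h1 : List.Forall₂ (fun x c => x = f c) (l.map f) l := by
    rw [List.forall₂_map_left_iff, List.forall₂_same]
    exact fun _ _ => rfl
  obtain ⟨l', h2, h3⟩ := List.perm_comp_forall₂ h h1
  refine ⟨l', h3, ?_⟩
  rwa [← List.forall₂_map_right_iff, List.forall₂_eq_eq_eq] at h2

namespace IsParallelCompositionOfPaths

variable {α β : Type*} {G : Graph α β} {s t : α} {k : ℕ} {len : Fin k → ℕ} {p : Fin k → ℕ → α}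
  {e : Fin k → ℕ → β} {A : List (List ℕ)} {ν : α → ℕ}

theorem adjacencyList_source (h : G.IsParallelCompositionOfPaths s t k len p e)
    (hν : G.IsNumbering A ν) : ∃ l : List (Fin k), l.Perm (List.finRange k) ∧
      A.getD (ν s) [] = l.map fun i => ν (p i 1) := by
  refine exists_map_eq_of_coe_eq_map ?_
  refine (hν.coe_eq_map (h.mem_vertexSet_iff.2 (Or.inl rfl)) (E := fun i => e i 0)
    (N := fun i => p i 1) ?_ ?_).trans ?_
  · intro i i' hi
    exact (h.edge_inj i 0 i' 0 (h.one_le_len i) (h.one_le_len i') hi).1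
  · intro f y
    rw [h.isLink_iff]
    constructor
    · rintro ⟨i, j, hj, rfl, ⟨h1, rfl⟩ | ⟨h1, rfl⟩⟩
      · obtain rfl := (h.apply_eq_source_iff hj.le).1 h1.symm
        exact ⟨i, rfl, rfl⟩
      · have := (h.apply_eq_source_iff hj).1 h1.symm
        omega
    · rintro ⟨i, rfl, rfl⟩
      exact ⟨i, 0, h.one_le_len i, rfl, Or.inl ⟨(h.first i).symm, rfl⟩⟩
  · rfl

theorem length_source (h : G.IsParallelCompositionOfPaths s t k len p e)
    (hν : G.IsNumbering A ν) : (A.getD (ν s) []).length = k := by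
  obtain ⟨l, hl, hA⟩ := h.adjacencyList_source hν
  rw [hA, List.length_map, hl.length_eq, List.length_finRange]

/-- Only the sum of the entries is recorded: the walk subtracts the previous vertex from it, which
makes the order of the list irrelevant. -/
theorem adjacencyList_inner (h : G.IsParallelCompositionOfPaths s t k len p e)
    (hν : G.IsNumbering A ν) {i : Fin k} {j : ℕ} (h0 : 0 < j) (h1 : j < len i) :
    ∃ x y, A.getD (ν (p i j)) [] = [x, y] ∧ x + y = ν (p i (j - 1)) + ν (p i (j + 1)) := by
  have := hν.coe_eq_map (h.mem_vertexSet h1.le) (E := fun c : Bool => e i (cond c (j - 1) j))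
    (N := fun c => p i (cond c (j - 1) (j + 1))) ?_ ?_
  · rw [show (Finset.univ : Finset Bool).val.map (fun c => ν (p i (cond c (j - 1) (j + 1)))) =
      (([ν (p i (j - 1)), ν (p i (j + 1))] : List ℕ) : Multiset ℕ) from rfl,
      Multiset.coe_eq_coe] at this
    obtain ⟨x, y, hxy⟩ := List.length_eq_two.1 this.length_eq
    refine ⟨x, y, hxy, ?_⟩
    have := this.sum_eq
    rw [hxy] at this
    simpa using this
  · intro c c' hc
    have := (h.edge_inj i _ i _ (by cases c <;> simp <;> omega)
      (by cases c' <;> simp <;> omega) hc).2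
    cases c <;> cases c' <;> simp at this ⊢ <;> omega
  · intro f y
    rw [h.isLink_iff]
    constructor
    · rintro ⟨i', j', hj, rfl, ⟨h2, rfl⟩ | ⟨h2, rfl⟩⟩
      · rcases h.eq_cases h1.le hj.le h2 with h3 | h3 | ⟨rfl, rfl, -⟩
        · omega
        · omega
        · exact ⟨false, rfl, rfl⟩
      · rcases h.eq_cases h1.le hj h2 with h3 | h3 | ⟨rfl, rfl, -⟩
        · omega
        · omega
        · exact ⟨true, rfl, rfl⟩
    · rintro ⟨c, rfl, rfl⟩
      cases c
      · exact ⟨i, j, h1, rfl, Or.inl ⟨rfl, rfl⟩⟩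
      · exact ⟨i, j - 1, by omega, rfl, Or.inr ⟨by congr 1; omega, rfl⟩⟩

theorem length_eq_two (h : G.IsParallelCompositionOfPaths s t k len p e)
    (hν : G.IsNumbering A ν) {a : ℕ} (ha : a < A.length) (hs : a ≠ ν s) (ht : a ≠ ν t) :
    (A.getD a []).length = 2 := by
  obtain ⟨x, hx, rfl⟩ := hν.bijOn.surjOn ha
  rcases h.mem_vertexSet_iff.1 hx with rfl | rfl | ⟨i, j, h0, h1, rfl⟩
  · exact absurd rfl hs
  · exact absurd rfl ht
  · obtain ⟨x, y, hxy, -⟩ := h.adjacencyList_inner hν h0 h1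
    rw [hxy]
    rfl

end IsParallelCompositionOfPaths

end Graph

/-! ### The memory layout -/

/-- The address at which the list of `v` begins. -/
def listAddress (A : List (List ℕ)) (v : ℕ) : ℕ := A.length + 2 + (A.take v).flatten.length

theorem listAddress_succ {A : List (List ℕ)} {v : ℕ} (hv : v < A.length) :
    listAddress A (v + 1) = listAddress A v + (A.getD v []).length := by
  rw [listAddress, listAddress, List.getD_eq_getElem _ _ hv, List.take_add_one,
    List.getElem?_eq_getElem hv, Option.toList_some, List.flatten_append, List.length_append,
    List.flatten_singleton, ← add_assoc]

theorem listAddress_eq_sum {A : List (List ℕ)} {v : ℕ} (hv : v ≤ A.length) :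
    listAddress A v = A.length + 2 + ∑ a ∈ Finset.range v, (A.getD a []).length := by
  induction v with
  | zero => simp [listAddress]
  | succ v ih => rw [listAddress_succ hv, ih (by omega), Finset.sum_range_succ, add_assoc]

theorem listAddress_le {A : List (List ℕ)} (v : ℕ) :
    listAddress A v ≤ A.length + 2 + A.flatten.length := by
  have := ((List.take_sublist v A).flatten).length_le
  unfold listAddress
  omega

theorem encode_getD_zero (A : List (List ℕ)) : (encodeAdjacencyList A).getD 0 0 = A.length := rfl

theorem encode_getD_succ {A : List (List ℕ)} {v : ℕ} (hv : v ≤ A.length) :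
    (encodeAdjacencyList A).getD (v + 1) 0 = listAddress A v := by
  rw [encodeAdjacencyList, List.getD_cons_succ, List.getD_append _ _ _ _ (by simp; omega),
    List.getD_eq_getElem _ _ (by simp; omega)]
  simp [listAddress]

theorem encode_getD_listAddress {A : List (List ℕ)} {v j : ℕ} (hv : v < A.length)
    (hj : j < (A.getD v []).length) :
    (encodeAdjacencyList A).getD (listAddress A v + j) 0 = (A.getD v []).getD j 0 := by
  rw [listAddress, show A.length + 2 + (A.take v).flatten.length + j =
    A.length + 1 + ((A.take v).flatten.length + j) + 1 by omega, encodeAdjacencyList,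
    List.getD_cons_succ, List.getD_append_right _ _ _ _ (by simp)]
  have h1 : A.flatten = (A.take v).flatten ++ (A.getD v [] ++ (A.drop (v + 1)).flatten) := by
    conv_lhs => rw [← List.take_append_drop v A, List.drop_eq_getElem_cons hv]
    rw [List.getD_eq_getElem _ _ hv, List.flatten_append, List.flatten_cons]
  rw [h1, List.length_map, List.length_range, Nat.add_sub_cancel_left,
    List.getD_append_right _ _ _ _ (by omega), Nat.add_sub_cancel_left,
    List.getD_append _ _ _ _ hj]

/-- `melonProgram` never stores, so this bounds the memory during the whole run. -/
theorem encode_getD_le {A : List (List ℕ)} (hA : ∀ L ∈ A, ∀ b ∈ L, b < A.length) (a : ℕ) :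
    (encodeAdjacencyList A).getD a 0 ≤ A.length + 2 + A.flatten.length := by
  by_cases ha : a < (encodeAdjacencyList A).length
  · rw [List.getD_eq_getElem _ _ ha]
    have hmem := List.getElem_mem ha
    generalize (encodeAdjacencyList A)[a] = x at hmem
    simp only [encodeAdjacencyList, List.mem_cons, List.mem_append, List.mem_map] at hmem
    rcases hmem with rfl | ⟨v, -, rfl⟩ | hx
    · omega
    · exact listAddress_le v
    · obtain ⟨L, hL, hx⟩ := List.mem_flatten.1 hx
      have := hA L hL x hx
      omega
  · rw [List.getD_eq_default _ _ (by omega)]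
    exact Nat.zero_le _

namespace Graph.IsParallelCompositionOfPaths

variable {α β : Type*} {G : Graph α β} {s t : α} {k : ℕ} {len : Fin k → ℕ} {p : Fin k → ℕ → α}
  {e : Fin k → ℕ → β} {A : List (List ℕ)} {ν : α → ℕ}

/-- Twice the number of edges is the sum of the degrees. -/
theorem length_flatten (h : G.IsParallelCompositionOfPaths s t k len p e)
    (hν : G.IsNumbering A ν) : A.flatten.length + 4 = 2 * A.length + 2 * k := by
  have hs : s ∈ G.vertexSet := h.mem_vertexSet_iff.2 (Or.inl rfl)
  have ht : t ∈ G.vertexSet := h.mem_vertexSet_iff.2 (Or.inr (Or.inl rfl))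
  have hst : ν s ≠ ν t := fun hst => h.source_ne_sink (hν.bijOn.injOn hs ht hst)
  have h1 := listAddress_eq_sum (le_refl A.length)
  -- The ends have degree `k` instead of 2; the corrections are added on both sides to avoid
  -- truncated subtraction.
  have h2 : ∑ a ∈ Finset.range A.length, ((A.getD a []).length + (if a = ν s then 2 else 0) +
      if a = ν t then 2 else 0) = ∑ a ∈ Finset.range A.length, (2 + (if a = ν s then k else 0) +
      if a = ν t then k else 0) := by
    refine Finset.sum_congr rfl fun a ha => ?_
    by_cases has : a = ν s
    · rw [has, h.length_source hν, if_pos rfl, if_pos rfl, if_neg hst, if_neg hst]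
      omega
    by_cases hat : a = ν t
    · rw [hat, h.reverse.length_source hν, if_pos rfl, if_pos rfl, if_neg hst.symm,
        if_neg hst.symm]
      omega
    · rw [h.length_eq_two hν (Finset.mem_range.1 ha) has hat]
      simp [has, hat]
  simp only [Finset.sum_add_distrib, Finset.sum_ite_eq', Finset.mem_range, hν.apply_lt hs,
    hν.apply_lt ht, if_true, Finset.sum_const, Finset.card_range, smul_eq_mul] at h2
  rw [listAddress, List.take_length] at h1
  omega

end Graph.IsParallelCompositionOfPaths

/-! ### Reasoning about random access machines -/

namespace RAM

/-- From the configuration `c`, the program halts after at most `T` steps with `output` in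
register `0`, and no number ever exceeds `W`. -/
def Finishes (P : Program) (output W T : ℕ) (c : Config) : Prop :=
  ∃ τ ≤ T, Halted P ((step P)^[τ] c) ∧ ((step P)^[τ] c).reg 0 = output ∧
    ∀ τ' ≤ τ, ∀ a, ((step P)^[τ'] c).reg a ≤ W ∧ ((step P)^[τ'] c).mem a ≤ W

section

variable {P : Program} {output W T : ℕ} {pc : ℕ} {r m : ℕ → ℕ}

theorem Finishes.mono {T' : ℕ} {c : Config} (h : Finishes P output W T c) (hT : T ≤ T') :
    Finishes P output W T' c :=
  let ⟨τ, hτ, h⟩ := h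
  ⟨τ, hτ.trans hT, h⟩

theorem finishes_of_halted (hm : ∀ a, m a ≤ W) (hr : ∀ a, r a ≤ W) (hP : P.length ≤ pc)
    (h0 : r 0 = output) : Finishes P output W T ⟨pc, r, m⟩ :=
  ⟨0, Nat.zero_le _, hP, h0, fun τ' hτ' a => by
    obtain rfl := Nat.le_zero.1 hτ'
    exact ⟨hr a, hm a⟩⟩

theorem finishes_of_step {I : Instr} (hP : P[pc]? = some I) (hm : ∀ a, m a ≤ W)
    (hr : ∀ a, r a ≤ W) (h : Finishes P output W T (I.exec ⟨pc, r, m⟩)) :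
    Finishes P output W (T + 1) ⟨pc, r, m⟩ := by
  have hstep : step P ⟨pc, r, m⟩ = I.exec ⟨pc, r, m⟩ := by simp [step, hP]
  obtain ⟨τ, hτ, h1, h2, h3⟩ := h
  refine ⟨τ + 1, by omega, ?_, ?_, fun τ' hτ' a => ?_⟩
  · rwa [Function.iterate_succ_apply, hstep]
  · rwa [Function.iterate_succ_apply, hstep]
  · cases τ' with
    | zero => exact ⟨hr a, hm a⟩
    | succ τ' =>
      rw [Function.iterate_succ_apply, hstep]
      exact h3 τ' (by omega) a

theorem update_le (hr : ∀ a, r a ≤ W) {i x : ℕ} (hx : x ≤ W) :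
    ∀ a, Function.update r i x a ≤ W := fun a => by
  rw [Function.update_apply]
  split_ifs
  exacts [hx, hr a]

/-- These rules work backwards from the end of the run. Each hands the bound on the updated
registers to the rest of the run. -/
theorem finishes_const {i x : ℕ} (hP : P[pc]? = some (.const i x)) (hm : ∀ a, m a ≤ W)
    (hr : ∀ a, r a ≤ W) (hx : x ≤ W)
    (h : (∀ a, Function.update r i x a ≤ W) →
      Finishes P output W T ⟨pc + 1, Function.update r i x, m⟩) :
    Finishes P output W (T + 1) ⟨pc, r, m⟩ :=
  finishes_of_step hP hm hr (h (update_le hr hx))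

theorem finishes_add {i j k x y : ℕ} (hP : P[pc]? = some (.add i j k)) (hm : ∀ a, m a ≤ W)
    (hr : ∀ a, r a ≤ W) (hx : r j = x) (hy : r k = y) (hxy : x + y ≤ W)
    (h : (∀ a, Function.update r i (x + y) a ≤ W) →
      Finishes P output W T ⟨pc + 1, Function.update r i (x + y), m⟩) :
    Finishes P output W (T + 1) ⟨pc, r, m⟩ := by
  subst hx hy
  exact finishes_of_step hP hm hr (h (update_le hr hxy))

theorem finishes_sub {i j k x y : ℕ} (hP : P[pc]? = some (.sub i j k)) (hm : ∀ a, m a ≤ W)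
    (hr : ∀ a, r a ≤ W) (hx : r j = x) (hy : r k = y)
    (h : (∀ a, Function.update r i (x - y) a ≤ W) →
      Finishes P output W T ⟨pc + 1, Function.update r i (x - y), m⟩) :
    Finishes P output W (T + 1) ⟨pc, r, m⟩ := by
  subst hx hy
  exact finishes_of_step hP hm hr (h (update_le hr ((Nat.sub_le _ _).trans (hr j))))

theorem finishes_load {i j x z : ℕ} (hP : P[pc]? = some (.load i j)) (hm : ∀ a, m a ≤ W)
    (hr : ∀ a, r a ≤ W) (hx : r j = x) (hz : m x = z)
    (h : (∀ a, Function.update r i z a ≤ W) →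
      Finishes P output W T ⟨pc + 1, Function.update r i z, m⟩) :
    Finishes P output W (T + 1) ⟨pc, r, m⟩ := by
  subst hx hz
  exact finishes_of_step hP hm hr (h (update_le hr (hm _)))

theorem finishes_jump {i l x : ℕ} (hP : P[pc]? = some (.jumpIfZero i l)) (hm : ∀ a, m a ≤ W)
    (hr : ∀ a, r a ≤ W) (hx : r i = x) (h0 : x = 0) (h : Finishes P output W T ⟨l, r, m⟩) :
    Finishes P output W (T + 1) ⟨pc, r, m⟩ := by
  refine finishes_of_step hP hm hr ?_
  simpa only [Instr.exec, hx, h0, if_true] using h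

theorem finishes_noJump {i l x : ℕ} (hP : P[pc]? = some (.jumpIfZero i l)) (hm : ∀ a, m a ≤ W)
    (hr : ∀ a, r a ≤ W) (hx : r i = x) (h0 : x ≠ 0)
    (h : Finishes P output W T ⟨pc + 1, r, m⟩) :
    Finishes P output W (T + 1) ⟨pc, r, m⟩ := by
  refine finishes_of_step hP hm hr ?_
  simpa only [Instr.exec, hx, h0, if_false] using h

end

/-- The program for melon graphs. Registers `1`, `10`, `11`, `15` hold the number of vertices and
the constants `1`, `2`, `0`; register `7` the source, `12` and `13` the rest of its list, `16` the
number of paths of even length found so far; on the current path, `17` and `18` hold the last two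
vertices and `19` the parity of the length so far. Finally half of register `6` is added to
register `0`. -/
def melonProgram : Program :=
  [.const 10 1, .const 11 2, .load 1 15, .add 2 1 10, .load 3 2, .sub 3 3 2, .add 4 1 1,
    .sub 5 4 3, .jumpIfZero 5 11, .sub 6 4 11, .jumpIfZero 15 59,
    .sub 5 3 4, .sub 5 5 10, .jumpIfZero 5 15, .jumpIfZero 15 17, .add 6 1 10, .jumpIfZero 15 59,
    .add 8 7 10, .add 9 8 10, .load 12 8, .load 13 9, .sub 14 13 12, .sub 14 14 11,
    .jumpIfZero 14 25, .jumpIfZero 15 27, .add 7 7 10, .jumpIfZero 15 17,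
    .sub 14 13 12, .jumpIfZero 14 53, .add 17 7 15, .load 18 12, .const 19 1,
    .add 8 18 10, .add 9 8 10, .load 20 8, .load 21 9, .sub 21 21 20, .sub 21 21 11,
    .jumpIfZero 21 40, .jumpIfZero 15 49, .load 22 20, .add 20 20 10, .load 23 20, .add 22 22 23,
    .sub 22 22 17, .add 17 18 15, .add 18 22 15, .sub 19 10 19, .jumpIfZero 15 32,
    .sub 19 10 19, .add 16 16 19, .add 12 12 10, .jumpIfZero 15 27,
    .sub 14 16 11, .jumpIfZero 14 58, .sub 6 1 16, .const 0 2, .jumpIfZero 15 59, .add 6 1 16,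
    .sub 14 6 10, .jumpIfZero 14 64, .sub 6 6 11, .add 0 0 10, .jumpIfZero 15 59]

/-! ### Verification of the loops of the program -/

variable {output W T : ℕ} {m : ℕ → ℕ}

/-- The final loop adds half of register `6` to register `0`. -/
theorem finishes_half (hm : ∀ a, m a ≤ W) (x y : ℕ) (r : ℕ → ℕ) (hr : ∀ a, r a ≤ W)
    (h15 : r 15 = 0) (h10 : r 10 = 1) (h11 : r 11 = 2) (h6 : r 6 = x) (h0 : r 0 = y)
    (hW : y + x ≤ W) (hout : output = y + x / 2) :
    Finishes melonProgram output W (5 * x + 2) ⟨59, r, m⟩ := by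
  induction x using Nat.strong_induction_on generalizing y r with
  | _ x ih =>
    refine finishes_sub rfl hm hr h6 h10 fun hr => ?_
    by_cases hx : x - 1 = 0
    · refine (finishes_jump (T := 5 * x) rfl hm hr rfl hx ?_)
      exact finishes_of_halted hm hr le_rfl (h0.trans (by omega))
    refine Finishes.mono (T := 5 * (x - 2) + 2 + 3 + 1) ?_ (by omega)
    refine finishes_noJump rfl hm hr rfl hx ?_
    refine finishes_sub rfl hm hr h6 h11 fun hr => ?_
    refine finishes_add rfl hm hr h0 h10 (by omega) fun hr => ?_
    refine finishes_jump rfl hm hr h15 rfl ?_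
    exact ih (x - 2) (by omega) (y + 1) _ hr h15 h10 h11 rfl rfl (by omega) (by omega)

/-- When the paths of even length have been counted, the result is computed. -/
theorem finishes_count (hm : ∀ a, m a ≤ W) {n q : ℕ} (r : ℕ → ℕ) (hr : ∀ a, r a ≤ W)
    (h15 : r 15 = 0) (h10 : r 10 = 1) (h11 : r 11 = 2) (h1 : r 1 = n) (h16 : r 16 = q)
    (h0 : r 0 = 0) (hW : 2 + n + q ≤ W)
    (hout : output = if q ≤ 2 then (n + q) / 2 else (n - q) / 2 + 2) :
    Finishes melonProgram output W (5 * (n + q) + 7) ⟨53, r, m⟩ := by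
  refine finishes_sub rfl hm hr h16 h11 fun hr => ?_
  by_cases hq : q - 2 = 0
  · refine Finishes.mono (T := 5 * (n + q) + 2 + 1 + 1) ?_ (by omega)
    refine finishes_jump rfl hm hr rfl hq ?_
    refine finishes_add rfl hm hr h1 h16 (by omega) fun hr => ?_
    exact finishes_half hm _ _ _ hr h15 h10 h11 rfl h0 (by omega)
      (by rw [hout, if_pos (by omega)]; omega)
  · refine Finishes.mono (T := 5 * (n - q) + 2 + 1 + 1 + 1 + 1) ?_ (by omega)
    refine finishes_noJump rfl hm hr rfl hq ?_
    refine finishes_sub rfl hm hr h1 h16 fun hr => ?_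
    -- The summand 2 of the formula for `q > 2` is put into register `0` before half of `n - q` is
    -- added.
    refine finishes_const rfl hm hr (by omega) fun hr => ?_
    refine finishes_jump rfl hm hr h15 rfl ?_
    exact finishes_half hm _ 2 _ hr h15 h10 h11 rfl rfl (by omega)
      (by rw [hout, if_neg (by omega)]; omega)

/-- Walking along a path of length `L` with vertices `q 0, …, q L`, of which only the last has
degree at least three. -/
theorem finishes_walk (hm : ∀ a, m a ≤ W) {L : ℕ} {q : ℕ → ℕ}
    (hinner : ∀ j, 0 < j → j < L → ∃ a x y, m (q j + 1) = a ∧ m (q j + 1 + 1) = a + 2 ∧ m a = x ∧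
      m (a + 1) = y ∧ x + y = q (j - 1) + q (j + 1))
    (hlast : m (q L + 1) + 3 ≤ m (q L + 1 + 1)) (hq : ∀ j ≤ L, 2 * q j + 2 ≤ W) (d j : ℕ)
    (hjd : j + d = L) (hj : 0 < j) (r : ℕ → ℕ) (hr : ∀ a, r a ≤ W) (h15 : r 15 = 0)
    (h10 : r 10 = 1) (h11 : r 11 = 2) (h17 : r 17 = q (j - 1)) (h18 : r 18 = q j)
    (h19 : r 19 = j % 2)
    (hend : ∀ r' : ℕ → ℕ, (∀ a, r' a ≤ W) → (∀ a, a ≤ 7 ∨ 10 ≤ a ∧ a ≤ 16 → r' a = r a) →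
      r' 19 = L % 2 → Finishes melonProgram output W T ⟨49, r', m⟩) :
    Finishes melonProgram output W (T + 17 * d + 8) ⟨32, r, m⟩ := by
  induction d generalizing j r with
  | zero =>
    obtain rfl : j = L := hjd
    have := hq j le_rfl
    refine finishes_add rfl hm hr h18 h10 (by omega) fun hr => ?_
    refine finishes_add (x := q j + 1) rfl hm hr rfl h10 (by omega) fun hr => ?_
    refine finishes_load (x := q j + 1) rfl hm hr rfl rfl fun hr => ?_
    refine finishes_load (x := q j + 1 + 1) rfl hm hr rfl rfl fun hr => ?_
    refine finishes_sub (x := m (q j + 1 + 1)) (y := m (q j + 1)) rfl hm hr rfl rfl fun hr => ?_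
    refine finishes_sub (x := m (q j + 1 + 1) - m (q j + 1)) rfl hm hr rfl h11 fun hr => ?_
    refine finishes_noJump (x := m (q j + 1 + 1) - m (q j + 1) - 2) rfl hm hr rfl (by omega) ?_
    refine finishes_jump rfl hm hr h15 rfl ?_
    refine hend _ hr (fun a ha => ?_) h19
    have h : a ≠ 8 ∧ a ≠ 9 ∧ a ≠ 20 ∧ a ≠ 21 := by omega
    simp [h]
  | succ d ih =>
    obtain ⟨a, x, y, ha, hb, hx, hy, hxy⟩ := hinner j hj (by omega)
    have h1 := hq j (by omega)
    have h2 := hq (j - 1) (by omega)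
    have h3 := hq (j + 1) (by omega)
    have h4 := hm (q j + 1 + 1)
    refine Finishes.mono (T := T + 17 * d + 8 + 16) ?_ (by omega)
    refine finishes_add rfl hm hr h18 h10 (by omega) fun hr => ?_
    refine finishes_add (x := q j + 1) rfl hm hr rfl h10 (by omega) fun hr => ?_
    refine finishes_load (x := q j + 1) rfl hm hr rfl ha fun hr => ?_
    refine finishes_load (x := q j + 1 + 1) rfl hm hr rfl hb fun hr => ?_
    refine finishes_sub (x := a + 2) (y := a) rfl hm hr rfl rfl fun hr => ?_
    refine finishes_sub (x := a + 2 - a) rfl hm hr rfl h11 fun hr => ?_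
    refine finishes_jump (x := a + 2 - a - 2) rfl hm hr rfl (by omega) ?_
    refine finishes_load (x := a) rfl hm hr rfl hx fun hr => ?_
    refine finishes_add (x := a) rfl hm hr rfl h10 (by omega) fun hr => ?_
    refine finishes_load (x := a + 1) rfl hm hr rfl hy fun hr => ?_
    refine finishes_add (x := x) (y := y) rfl hm hr rfl rfl (by omega) fun hr => ?_
    -- Subtracting the previous vertex from the sum of the neighbours leaves the next vertex.
    refine finishes_sub (x := x + y) rfl hm hr rfl h17 fun hr => ?_
    refine finishes_add rfl hm hr h18 h15 (by omega) fun hr => ?_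
    refine finishes_add (x := x + y - q (j - 1)) rfl hm hr rfl h15 (by omega) fun hr => ?_
    refine finishes_sub rfl hm hr h10 h19 fun hr => ?_
    refine finishes_jump rfl hm hr h15 rfl ?_
    refine ih (j + 1) (by omega) (by omega) _ hr h15 h10 h11 rfl ?_ ?_ fun r' hr' hreg h19' => ?_
    · change x + y - q (j - 1) + 0 = q (j + 1)
      omega
    · change 1 - j % 2 = (j + 1) % 2
      omega
    · refine hend r' hr' (fun a ha => (hreg a ha).trans ?_) h19'
      have h : a ≠ 8 ∧ a ≠ 9 ∧ a ≠ 17 ∧ a ≠ 18 ∧ a ≠ 19 ∧ a ≠ 20 ∧ a ≠ 21 ∧ a ≠ 22 ∧ a ≠ 23 := by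
        omega
      simp [h]

/-- Walking along the paths beginning at the source `S` and counting those of even length. -/
theorem finishes_paths (hm : ∀ a, m a ≤ W) {k n S : ℕ} {len : Fin k → ℕ} {q : Fin k → ℕ → ℕ}
    (hinner : ∀ i j, 0 < j → j < len i → ∃ a x y, m (q i j + 1) = a ∧ m (q i j + 1 + 1) = a + 2 ∧
      m a = x ∧ m (a + 1) = y ∧ x + y = q i (j - 1) + q i (j + 1))
    (hlast : ∀ i, m (q i (len i) + 1) + 3 ≤ m (q i (len i) + 1 + 1))
    (hq : ∀ i, ∀ j ≤ len i, 2 * q i j + 2 ≤ W) (hS : ∀ i, q i 0 = S) (hlen : ∀ i, 1 ≤ len i)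
    (l : List (Fin k)) (a c : ℕ) (r : ℕ → ℕ) (hr : ∀ a, r a ≤ W) (h15 : r 15 = 0)
    (h10 : r 10 = 1) (h11 : r 11 = 2) (h1 : r 1 = n) (h0 : r 0 = 0) (h7 : r 7 = S)
    (h12 : r 12 = a) (h13 : r 13 = a + l.length) (h16 : r 16 = c)
    (hl : ∀ x (hx : x < l.length), m (a + x) = q l[x] 1)
    (hW : 2 + n + (c + (l.map fun i => if len i % 2 = 0 then 1 else 0).sum) ≤ W)
    (hout : output = if c + (l.map fun i => if len i % 2 = 0 then 1 else 0).sum ≤ 2 then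
      (n + (c + (l.map fun i => if len i % 2 = 0 then 1 else 0).sum)) / 2 else
      (n - (c + (l.map fun i => if len i % 2 = 0 then 1 else 0).sum)) / 2 + 2) :
    Finishes melonProgram output W ((l.map fun i => 17 * len i).sum +
      (5 * (n + (c + (l.map fun i => if len i % 2 = 0 then 1 else 0).sum)) + 7) + 2)
      ⟨27, r, m⟩ := by
  induction l generalizing a c r with
  | nil =>
    simp only [List.map_nil, List.sum_nil, add_zero, zero_add] at hW hout ⊢
    refine finishes_sub rfl hm hr h13 h12 fun hr => ?_
    refine finishes_jump (x := a + 0 - a) rfl hm hr rfl (by simp) ?_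
    exact finishes_count hm _ hr h15 h10 h11 h1 h16 h0 (by omega) hout
  | cons i l ih =>
    simp only [List.map_cons, List.sum_cons, List.length_cons, ← add_assoc c] at hW hout h13 hl ⊢
    have h2 := hlen i
    have h3 := hq i 0 (by omega)
    have h4 := hq i 1 h2
    -- Five instructions precede the walk and four follow it; with `17 * (len i - 1) + 8` for the
    -- walk this makes exactly `17 * len i`.
    refine Finishes.mono (T := (l.map fun i => 17 * len i).sum + (5 * (n + (c +
      (if len i % 2 = 0 then 1 else 0) +
      (l.map fun i => if len i % 2 = 0 then 1 else 0).sum)) + 7) + 2 + 4 + 17 * (len i - 1) + 8 + 5)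
      ?_ (by omega)
    refine finishes_sub rfl hm hr h13 h12 fun hr => ?_
    refine finishes_noJump (x := a + (l.length + 1) - a) rfl hm hr rfl (by omega) ?_
    refine finishes_add rfl hm hr h7 h15 (by rw [← hS i]; omega) fun hr => ?_
    refine finishes_load rfl hm hr h12 (hl 0 (by omega)) fun hr => ?_
    refine finishes_const rfl hm hr (by omega) fun hr => ?_
    refine finishes_walk hm (hinner i) (hlast i) (hq i) (len i - 1) 1 (by omega) one_pos _ hr h15
      h10 h11 (hS i).symm rfl rfl fun r' hr' hreg h19 => ?_
    have hreg' : ∀ b, b ≤ 7 ∨ 10 ≤ b ∧ b ≤ 13 ∨ b = 15 ∨ b = 16 → r' b = r b := by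
      intro b hb
      have h : b ≠ 14 ∧ b ≠ 17 ∧ b ≠ 18 ∧ b ≠ 19 := by omega
      rw [hreg b (by omega)]
      simp [h]
    rw [← hreg' _ (by omega)] at h15 h10 h11 h1 h0 h7 h12 h13 h16
    have h5 := hr' 13
    refine finishes_sub rfl hm hr' h10 h19 fun hr => ?_
    refine finishes_add (y := 1 - len i % 2) rfl hm hr h16 rfl (by omega) fun hr => ?_
    refine finishes_add rfl hm hr h12 h10 (by omega) fun hr => ?_
    refine finishes_jump rfl hm hr h15 rfl ?_
    have h6 : 1 - len i % 2 = if len i % 2 = 0 then 1 else 0 := by split_ifs <;> omega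
    refine ih (a + 1) _ _ hr h15 h10 h11 h1 h0 h7 rfl (h13.trans (by omega))
      (congrArg (c + ·) h6) (fun x hx => ?_) hW hout
    have := hl (x + 1) (by omega)
    rwa [show a + (x + 1) = a + 1 + x by omega, List.getElem_cons_succ] at this

/-- Finding the first vertex of degree at least three; `z` is such a vertex. -/
theorem finishes_find (hm : ∀ a, m a ≤ W) {z : ℕ} (hz : m (z + 1) + 3 ≤ m (z + 1 + 1))
    (hzW : z + 2 ≤ W) (d v : ℕ) (hvd : v + d = z) (r : ℕ → ℕ) (hr : ∀ a, r a ≤ W) (h15 : r 15 = 0)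
    (h10 : r 10 = 1) (h11 : r 11 = 2) (h7 : r 7 = v)
    (hend : ∀ v ≤ z, m (v + 1) + 3 ≤ m (v + 1 + 1) → ∀ r' : ℕ → ℕ, (∀ a, r' a ≤ W) →
      (∀ a, a ≤ 6 ∨ a = 10 ∨ a = 11 ∨ 15 ≤ a → r' a = r a) → r' 7 = v → r' 12 = m (v + 1) →
      r' 13 = m (v + 1 + 1) → Finishes melonProgram output W T ⟨27, r', m⟩) :
    Finishes melonProgram output W (T + 9 * d + 8) ⟨17, r, m⟩ := by
  induction d generalizing v r with
  | zero =>
    obtain rfl : v = z := hvd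
    refine finishes_add rfl hm hr h7 h10 (by omega) fun hr => ?_
    refine finishes_add (x := v + 1) rfl hm hr rfl h10 (by omega) fun hr => ?_
    refine finishes_load (x := v + 1) rfl hm hr rfl rfl fun hr => ?_
    refine finishes_load (x := v + 1 + 1) rfl hm hr rfl rfl fun hr => ?_
    refine finishes_sub (x := m (v + 1 + 1)) (y := m (v + 1)) rfl hm hr rfl rfl fun hr => ?_
    refine finishes_sub (x := m (v + 1 + 1) - m (v + 1)) rfl hm hr rfl h11 fun hr => ?_
    refine finishes_noJump (x := m (v + 1 + 1) - m (v + 1) - 2) rfl hm hr rfl (by omega) ?_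
    refine finishes_jump rfl hm hr h15 rfl ?_
    refine hend v le_rfl hz _ hr (fun a ha => ?_) h7 rfl rfl
    have h : a ≠ 8 ∧ a ≠ 9 ∧ a ≠ 12 ∧ a ≠ 13 ∧ a ≠ 14 := by omega
    simp [h]
  | succ d ih =>
    refine Finishes.mono (T := T + 9 * d + 8 + 9) ?_ (by omega)
    refine finishes_add rfl hm hr h7 h10 (by omega) fun hr => ?_
    refine finishes_add (x := v + 1) rfl hm hr rfl h10 (by omega) fun hr => ?_
    refine finishes_load (x := v + 1) rfl hm hr rfl rfl fun hr => ?_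
    refine finishes_load (x := v + 1 + 1) rfl hm hr rfl rfl fun hr => ?_
    refine finishes_sub (x := m (v + 1 + 1)) (y := m (v + 1)) rfl hm hr rfl rfl fun hr => ?_
    refine finishes_sub (x := m (v + 1 + 1) - m (v + 1)) rfl hm hr rfl h11 fun hr => ?_
    by_cases h0 : m (v + 1 + 1) - m (v + 1) - 2 = 0
    · refine finishes_jump rfl hm hr rfl h0 ?_
      refine finishes_add rfl hm hr h7 h10 (by omega) fun hr => ?_
      refine finishes_jump rfl hm hr h15 rfl ?_
      refine ih (v + 1) (by omega) _ hr h15 h10 h11 rfl fun v' hv' hd r' hr' hreg => ?_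
      refine hend v' hv' hd r' hr' fun a ha => (hreg a ha).trans ?_
      have h : a ≠ 7 ∧ a ≠ 8 ∧ a ≠ 9 ∧ a ≠ 12 ∧ a ≠ 13 ∧ a ≠ 14 := by omega
      simp [h]
    -- A vertex of degree at least three may come before `z`, so `hend` has to cover every such
    -- vertex.
    · refine Finishes.mono (T := T + 2) ?_ (by omega)
      refine finishes_noJump rfl hm hr rfl h0 ?_
      refine finishes_jump rfl hm hr h15 rfl ?_
      refine (hend v (by omega) (by omega) _ hr (fun a ha => ?_) h7 rfl rfl)
      have h : a ≠ 8 ∧ a ≠ 9 ∧ a ≠ 12 ∧ a ≠ 13 ∧ a ≠ 14 := by omega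
      simp [h]

/-- The beginning of the program, which separates paths, cycles and the other melon graphs. -/
theorem finishes_start (hm : ∀ a, m a ≤ W) {n k : ℕ} (h2 : 2 ≤ n) (hk : 1 ≤ k) (h0 : m 0 = n)
    (hD : m (n + 1) + 2 = 3 * n + 2 * k) (hW : 2 * n + 2 ≤ W)
    (hout1 : k = 1 → output = n - 1) (hout2 : k = 2 → output = (n + 1) / 2)
    (hend : 3 ≤ k → ∀ r : ℕ → ℕ, (∀ a, r a ≤ W) → r 0 = 0 → r 1 = n → r 7 = 0 → r 10 = 1 →
      r 11 = 2 → r 15 = 0 → r 16 = 0 → Finishes melonProgram output W T ⟨17, r, m⟩) :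
    Finishes melonProgram output W (T + 10 * n + 20) ⟨0, fun _ => 0, m⟩ := by
  refine finishes_const rfl hm (fun _ => Nat.zero_le _) (by omega) fun hr => ?_
  refine finishes_const rfl hm hr (by omega) fun hr => ?_
  refine finishes_load (x := 0) rfl hm hr rfl h0 fun hr => ?_
  refine finishes_add (x := n) (y := 1) rfl hm hr rfl rfl (by omega) fun hr => ?_
  refine finishes_load (x := n + 1) rfl hm hr rfl rfl fun hr => ?_
  refine finishes_sub (x := m (n + 1)) (y := n + 1) rfl hm hr rfl rfl fun hr => ?_
  refine finishes_add (x := n) (y := n) rfl hm hr rfl rfl (by omega) fun hr => ?_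
  -- By `hD` the number `m (n + 1) - (n + 1)` is `2 * n + 2 * k - 3`: below `2 * n` for `k = 1`,
  -- equal to `2 * n + 1` for `k = 2`, and larger otherwise.
  refine finishes_sub (x := n + n) (y := m (n + 1) - (n + 1)) rfl hm hr rfl rfl fun hr => ?_
  by_cases hk1 : k = 1
  · refine finishes_noJump (x := n + n - (m (n + 1) - (n + 1))) rfl hm hr rfl (by omega) ?_
    refine finishes_sub (x := n + n) (y := 2) rfl hm hr rfl rfl fun hr => ?_
    refine finishes_jump (x := 0) rfl hm hr rfl rfl ?_
    exact (finishes_half hm (n + n - 2) 0 _ hr rfl rfl rfl rfl rfl (by omega)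
      (by rw [hout1 hk1]; omega)).mono (by omega)
  refine finishes_jump (x := n + n - (m (n + 1) - (n + 1))) rfl hm hr rfl (by omega) ?_
  refine finishes_sub (x := m (n + 1) - (n + 1)) (y := n + n) rfl hm hr rfl rfl fun hr => ?_
  refine finishes_sub (x := m (n + 1) - (n + 1) - (n + n)) (y := 1) rfl hm hr rfl rfl fun hr => ?_
  by_cases hk2 : k = 2
  · refine finishes_jump (x := m (n + 1) - (n + 1) - (n + n) - 1) rfl hm hr rfl (by omega) ?_
    refine finishes_add (x := n) (y := 1) rfl hm hr rfl rfl (by omega) fun hr => ?_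
    refine finishes_jump (x := 0) rfl hm hr rfl rfl ?_
    exact (finishes_half hm (n + 1) 0 _ hr rfl rfl rfl rfl rfl (by omega)
      (by rw [hout2 hk2]; omega)).mono (by omega)
  · refine finishes_noJump (x := m (n + 1) - (n + 1) - (n + n) - 1) rfl hm hr rfl (by omega) ?_
    refine finishes_jump (x := 0) rfl hm hr rfl rfl ?_
    exact (hend (by omega) _ hr rfl rfl rfl rfl rfl rfl rfl).mono (by omega)

end RAM

/-! ### Correctness of the program on melon graphs -/

namespace Graph.IsParallelCompositionOfPaths

variable {α β : Type*} {G : Graph α β} {s t : α} {k : ℕ} {len : Fin k → ℕ} {p : Fin k → ℕ → α}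
  {e : Fin k → ℕ → β} {A : List (List ℕ)} {ν : α → ℕ}

theorem sum_map_of_perm {l : List (Fin k)} (hl : l.Perm (List.finRange k)) (f : Fin k → ℕ) :
    (l.map f).sum = ∑ i, f i := by
  rw [(hl.map f).sum_eq, Fin.sum_univ_def]

/-- Makes the total time of the walks linear in the number of vertices and `k`. -/
theorem sum_len (h : G.IsParallelCompositionOfPaths s t k len p e) (hν : G.IsNumbering A ν) :
    ∑ i, len i + 2 = A.length + k := by
  have h1 := h.ncard_vertexSet
  rw [hν.ncard_eq] at h1
  have h2 : ∑ i, len i = ∑ i, (len i - 1) + k := by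
    have : ∑ i, (len i - 1) + k = ∑ i, (len i - 1 + 1) := by simp [Finset.sum_add_distrib]
    rw [this]
    exact Finset.sum_congr rfl fun i _ => by have := h.one_le_len i; omega
  omega

theorem address_succ {v : ℕ} (hv : v < A.length) :
    (encodeAdjacencyList A).getD (v + 1 + 1) 0 =
      (encodeAdjacencyList A).getD (v + 1) 0 + (A.getD v []).length := by
  rw [encode_getD_succ hv, encode_getD_succ hv.le, listAddress_succ hv]

theorem entry_eq {v j : ℕ} (hv : v < A.length) (hj : j < (A.getD v []).length) :
    (encodeAdjacencyList A).getD ((encodeAdjacencyList A).getD (v + 1) 0 + j) 0 =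
      (A.getD v []).getD j 0 := by
  rw [encode_getD_succ hv.le, encode_getD_listAddress hv hj]

/-- From the source on, the program is correct. -/
theorem finishes_from_source (h : G.IsParallelCompositionOfPaths s t k len p e)
    (hν : G.IsNumbering A ν) (hk : 3 ≤ k) {W : ℕ} (hW : 3 * A.length + 2 * k + 2 ≤ W)
    (hm : ∀ a, (encodeAdjacencyList A).getD a 0 ≤ W) {r : ℕ → ℕ} (hr : ∀ a, r a ≤ W)
    (h15 : r 15 = 0) (h10 : r 10 = 1) (h11 : r 11 = 2) (h1 : r 1 = A.length) (h0 : r 0 = 0)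
    (h7 : r 7 = ν s) (h12 : r 12 = (encodeAdjacencyList A).getD (ν s + 1) 0)
    (h13 : r 13 = (encodeAdjacencyList A).getD (ν s + 1 + 1) 0) (h16 : r 16 = 0) :
    RAM.Finishes RAM.melonProgram G.evc W (22 * A.length + 22 * k + 9)
      ⟨27, r, fun a => (encodeAdjacencyList A).getD a 0⟩ := by
  have hs : ν s < A.length := hν.apply_lt (h.mem_vertexSet_iff.2 (Or.inl rfl))
  have ht : ν t < A.length := hν.apply_lt (h.mem_vertexSet_iff.2 (Or.inr (Or.inl rfl)))
  obtain ⟨l, hl, hA⟩ := h.adjacencyList_source hν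
  have hll : l.length = k := by rw [hl.length_eq, List.length_finRange]
  have hlen := h.sum_len hν
  have hsum : (l.map fun i => if len i % 2 = 0 then 1 else 0).sum = evenCount len :=
    sum_map_of_perm hl _
  have hsum' : (l.map fun i => 17 * len i).sum = 17 * ∑ i, len i := by
    rw [sum_map_of_perm hl, Finset.mul_sum]
  have hq := evenCount_le len
  have hfin := RAM.finishes_paths (output := G.evc) (n := A.length) (S := ν s) (len := len)
    (q := fun i j => ν (p i j)) (m := fun a => (encodeAdjacencyList A).getD a 0) hm
    (fun i j hj0 hj1 => ?_) (fun i => ?_) (fun i j hj => ?_) (fun i => by rw [h.first])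
    h.one_le_len l _ 0 r hr h15 h10 h11 h1 h0 h7 h12 ?_ h16 (fun x hx => ?_) ?_ ?_
  · refine hfin.mono ?_
    rw [hsum, hsum']
    omega
  · obtain ⟨x, y, hxy, hadd⟩ := h.adjacencyList_inner hν hj0 hj1
    have hlt : ν (p i j) < A.length := hν.apply_lt (h.mem_vertexSet hj1.le)
    refine ⟨_, x, y, rfl, ?_, ?_, ?_, hadd⟩
    · rw [address_succ hlt, hxy]
      rfl
    · have := entry_eq (j := 0) hlt (by rw [hxy]; simp)
      rw [hxy] at this
      exact this
    · have := entry_eq (j := 1) hlt (by rw [hxy]; simp)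
      rw [hxy] at this
      exact this
  · simp only [h.last]
    rw [address_succ ht, h.reverse.length_source hν]
    omega
  · have := hν.apply_lt (h.mem_vertexSet hj)
    omega
  · rw [h13, address_succ hs, h.length_source hν, hll]
  · rw [entry_eq hs (by rw [hA, List.length_map]; exact hx), hA,
      List.getD_eq_getElem _ _ (by rw [List.length_map]; exact hx), List.getElem_map]
  · rw [hsum]
    omega
  · rw [hsum, zero_add, h.evc_eq, melonNumber, if_neg (by omega), if_neg (by omega), hν.ncard_eq]

theorem melonProgram_computes (h : G.IsParallelCompositionOfPaths s t k len p e)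
    (hν : G.IsNumbering A ν) {W : ℕ} (hW : 3 * A.length + 2 * k + 2 ≤ W) :
    RAM.Computes RAM.melonProgram (encodeAdjacencyList A) G.evc (41 * A.length + 22 * k + 37)
      W := by
  have hsV : s ∈ G.vertexSet := h.mem_vertexSet_iff.2 (Or.inl rfl)
  have htV : t ∈ G.vertexSet := h.mem_vertexSet_iff.2 (Or.inr (Or.inl rfl))
  have hs : ν s < A.length := hν.apply_lt hsV
  have ht : ν t < A.length := hν.apply_lt htV
  have hst : ν s ≠ ν t := fun hst => h.source_ne_sink (hν.bijOn.injOn hsV htV hst)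
  have hflat := h.length_flatten hν
  have hk := h.one_le_k
  have hm : ∀ a, (encodeAdjacencyList A).getD a 0 ≤ W := fun a =>
    (encode_getD_le (fun L hL b hb => by
      obtain ⟨i, hi, rfl⟩ := List.getElem_of_mem hL
      exact hν.entry_lt i hi b hb) a).trans (by omega)
  have hdeg : ∀ v < A.length, 3 ≤ (A.getD v []).length → v = ν s ∨ v = ν t := by
    intro v hv h3
    by_contra! hcon
    rw [h.length_eq_two hν hv hcon.1 hcon.2] at h3
    omega
  refine (RAM.finishes_start (n := A.length) (k := k) (output := G.evc) (W := W)
    (T := 22 * A.length + 22 * k + 9 + 9 * ν s + 8)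
    (m := fun a => (encodeAdjacencyList A).getD a 0) hm
    (by omega) hk (encode_getD_zero A) ?_ (by omega) ?_ ?_
    fun hk3 r hr h0 h1 h7 h10 h11 h15 h16 => ?_).mono (by omega)
  · rw [encode_getD_succ le_rfl, listAddress, List.take_length]
    omega
  · intro hk1
    rw [h.evc_eq, melonNumber, if_pos hk1, hν.ncard_eq]
  · intro hk2
    rw [h.evc_eq, melonNumber, if_neg (by omega), if_pos hk2, hν.ncard_eq]
  · refine RAM.finishes_find hm (z := ν s) ?_ (by omega) (ν s) 0 (zero_add _) r hr h15 h10 h11 h7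
      fun v hv hd r' hr' hreg h7' h12' h13' => ?_
    · rw [address_succ hs, h.length_source hν]
      omega
    rw [← hreg _ (by omega)] at h0 h1 h10 h11 h15 h16
    rw [address_succ (by omega)] at hd
    -- The vertex found is the source or the sink, and the sink is the source of the reversed melon
    -- graph.
    rcases hdeg v (by omega) (by omega) with rfl | rfl
    · exact h.finishes_from_source hν hk3 hW hm hr' h15 h10 h11 h1 h0 h7' h12' h13' h16
    · exact h.reverse.finishes_from_source hν hk3 hW hm hr' h15 h10 h11 h1 h0 h7' h12' h13' h16

end Graph.IsParallelCompositionOfPaths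

theorem theorem1 :
    ∃ (P : RAM.Program) (C : ℕ), ∀ (α : Type*) (β : Type*) (G : Graph α β) (A : List (List ℕ)),
      G.IsMelon → G.IsAdjacencyList A →
        RAM.Computes P (encodeAdjacencyList A) G.evc
          (C * (G.vertexSet.ncard + G.edgeSet.ncard))
          (C * (G.vertexSet.ncard + G.edgeSet.ncard)) := by
  -- The constant 60 suffices because `k` is at most the number of edges and there are at least two
  -- vertices, so that the bound `41 * n + 22 * k + 37` absorbs its last summand.
  refine ⟨RAM.melonProgram, 60, fun α β G A ⟨s, t, k, len, p, e, h⟩ hA => ?_⟩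
  obtain ⟨ν, hν⟩ := hA.exists_isNumbering
  have hk := h.le_ncard_edgeSet
  have hn := h.ncard_vertexSet
  have hnA := hν.ncard_eq
  obtain ⟨τ, hτ, hrun⟩ := h.melonProgram_computes hν
    (W := 60 * (G.vertexSet.ncard + G.edgeSet.ncard)) (by omega)
  exact ⟨τ, by omega, hrun⟩
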